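/- Let $V$ be a three-dimensional complex vector space with a hermitian form $\langle-,-\rangle$ (linear in the first argument) of signature $++-$, let $\mathbb B\subset\mathbb P V$ be the set of negative points (the complex hyperbolic plane) and $\overline{\mathbb B}$ the set of nonpositive points. A complex geodesic is a set $\mathbb P p^\perp\cap\overline{\mathbb B}$ with $p$ positive (its polar point); two of them are ultraparallel if they are disjoint in $\overline{\mathbb B}$. For ultraparallel $S,S'$ with polar points $p,p'$, there is a unique full bisector having $S$ and $S'$ as slices: its real spine is the extended geodesic through $p$ and $p'$, and it is the part in $\overline{\mathbb B}$ of the projective cone over the real spine with vertex the point polar to the complex line through $p,p'$. Let $\mathrm B[S,S']$ be the segment of it formed by the slices from $S$ to $S'$, let its middle slice be the slice of the segment the reflection in which exchanges $S$ and $S'$, and let $\prec\!\mathrm B[S,S']\!\succ$ be the full bisector, oriented by its real spine, directed from $S$ to $S'$, and the complex orientation of its slices. At a point of $S\cap\mathbb B$ the normal vector of $\prec\!\mathrm B[S,S']\!\succ$ is $i$ times the direction in the bisector that is orthogonal to $S$ and agrees with the direction of the real spine; $K^+$ and $K^-$ are the closed half-spaces of $\overline{\mathbb B}$ bounded by $\prec\!\mathrm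 B[S,S']\!\succ$ on the side of the normal vector and on the other side. The oriented angle in $[0,2\pi)$ from $\mathrm B[C,M]$ to $\mathrm B[C,M']$ at a point of $C\cap\mathbb B$ is the angle from the first normal vector to the second one in the complex line of tangent vectors orthogonal to $C$. If the full bisectors are transversal along $C$ (always including the ideal points of $C$), the sector from $\mathrm B[C,M]$ to $\mathrm B[C,M']$ is $K^+\cap K'^-$ if this angle is at most $\pi$, and $K^+\cup K'^-$ otherwise; here $K^\pm$, $K'^\pm$ are the half-spaces of the two full bisectors. A triangle $\Delta(C,M_1,M_2)$ of pairwise ultraparallel complex geodesics is transversal if the full bisectors of $\mathrm B[C,M_1]$, $\mathrm B[M_1,M_2]$, $\mathrm B[M_2,C]$ are pairwise transversal along their common slices. Its interior sector at $C$ is that one of the sectors from $\mathrm B[C,M_1]$ to $\mathrm B[C,M_2]$ and from $\mathrm B[C,M_2]$ to $\mathrm B[C,M_1]$ whose angle is less than $\pi$. A transversal triangle $\Delta(S,M_2,M_1)$ is transversally adjacent to a transversal triangle $\Delta(C,M_1,M_2)$ if some point of $S$ lies in the interior sector of the latter at $C$ and if, for $j=1,2$, the full bisectors of $\mathrm B[C,M_j]$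 and $\mathrm B[M_j,S]$ are transversal along $M_j$. Let $S_i$ ($i\in\mathbb Z/n$, $n\ge1$) be complex geodesics such that $S_i$ and $S_{i+1}$ are ultraparallel for all $i$, let $\mathrm B_i:=\mathrm B[S_i,S_{i+1}]$, and let $M_i$ be the middle slice of $\mathrm B_i$. Suppose that the configuration $(\mathrm B_1,\dots,\mathrm B_n)$ is transversal: for all $i$, $\mathrm B_{i-1}\cap\mathrm B_i=S_i$ and the full bisectors of $\mathrm B_{i-1}$ and $\mathrm B_i$ are transversal along $S_i$. Suppose that it possesses a centre $C$: a complex geodesic ultraparallel to every $M_i$ such that, for $\mathrm B'_i:=\mathrm B[C,M_i]$, the full bisectors of $\mathrm B'_{i-1}$ and $\mathrm B'_i$ are transversal along $C$ for all $i$. Suppose that, for every $i$, the triangles $\Delta_i:=\Delta(C,M_{i-1},M_i)$ and $\Delta'_i:=\Delta(S_i,M_i,M_{i-1})$ are transversal and $\Delta'_i$ is transversally adjacent to $\Delta_i$. Suppose finally that at some point of $C\cap\mathbb B$ the central angle, i.e. the sum over $i$ of the oriented angles from $\mathrm B'_{i-1}$ to $\mathrm B'_i$, equals $2\pi$, and that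 for every $i$ the oriented angle from $\mathrm B'_{i-1}$ to $\mathrm B'_i$ at some point of $C\cap\mathbb B$ does not exceed $\pi$. Then the configuration is simple: $\mathrm B_i\cap\mathrm B_j\ne\varnothing$ implies $j\in\{i-1,i,i+1\}$, and $\mathrm B_{i-1}\cap\mathrm B_i=S_i$ for all $i$. -/

import Mathlib

open scoped LinearAlgebra.Projectivization

namespace ComplexHyperbolic

universe u

/-- `h` is a hermitian form (complex-linear in the first argument) of signature `++-` on a
three-dimensional complex vector space. -/
structure IsHermitianPPM {V : Type u} [AddCommGroup V] [Module ℂ V]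
    (h : V →ₗ[ℂ] V →ₗ⋆[ℂ] ℂ) : Prop where
  hermitian : ∀ x y : V, h y x = (starRingEnd ℂ) (h x y)
  signature : ∃ e : Module.Basis (Fin 3) ℂ V,
    ∀ i j, h (e i) (e j) = if i = j then (![1, 1, -1] : Fin 3 → ℂ) i else 0

section

variable {V : Type u} [AddCommGroup V] [Module ℂ V]

/-- The complex hyperbolic plane: the negative points of the projective plane. -/
def openBall (h : V →ₗ[ℂ] V →ₗ⋆[ℂ] ℂ) : Set (ℙ ℂ V) := {x | (h x.rep x.rep).re < 0}

/-- The complex hyperbolic plane together with its ideal boundary (the isotropic points). -/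
def closedBall (h : V →ₗ[ℂ] V →ₗ⋆[ℂ] ℂ) : Set (ℙ ℂ V) := {x | (h x.rep x.rep).re ≤ 0}

/-- A complex geodesic, given by its polar point, which is positive. -/
structure ComplexGeodesic (h : V →ₗ[ℂ] V →ₗ⋆[ℂ] ℂ) where
  polar : ℙ ℂ V
  pos : 0 < (h polar.rep polar.rep).re

/-- The linear map `x ↦ 2 (⟨x, p⟩ / ⟨p, p⟩) p - x`. -/
noncomputable def reflection (h : V →ₗ[ℂ] V →ₗ⋆[ℂ] ℂ) (p : V) : V →ₗ[ℂ] V :=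
  (2 / h p p) • (h.flip p).smulRight p - LinearMap.id

theorem reflection_injective (h : V →ₗ[ℂ] V →ₗ⋆[ℂ] ℂ) {p : V} (hp : h p p ≠ 0) :
    Function.Injective (reflection h p) := by
  have key : ∀ x, reflection h p (reflection h p x) = x := by
    intro x
    simp only [reflection, LinearMap.sub_apply, LinearMap.smul_apply, LinearMap.smulRight_apply,
      LinearMap.flip_apply, LinearMap.id_apply, map_sub, map_smul, smul_sub,
      smul_smul]
    have e : 2 / h p p * h x p * (2 / h p p * h p p) = 2 / h p p * h x p + 2 / h p p * h x p := by
      field_simp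
      ring
    rw [e, add_smul]
    abel
  exact Function.LeftInverse.injective key

namespace ComplexGeodesic

variable {h : V →ₗ[ℂ] V →ₗ⋆[ℂ] ℂ}

/-- A representative in `V` of the polar point. -/
noncomputable def vec (C : ComplexGeodesic h) : V := C.polar.rep

/-- The points of a complex geodesic, the ideal ones included. -/
def points (C : ComplexGeodesic h) : Set (ℙ ℂ V) := {x | x ∈ closedBall h ∧ h x.rep C.vec = 0}

/-- The reflection of the projective plane in a complex geodesic. -/
noncomputable def reflect (M : ComplexGeodesic h) : ℙ ℂ V → ℙ ℂ V :=
  Projectivization.map (reflection h M.vec) (reflection_injective h (p := M.vec) (by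
    intro h0
    have hp := M.pos
    change 0 < (h M.vec M.vec).re at hp
    rw [h0] at hp
    simp at hp))

/-- Two complex geodesics are ultraparallel if they have no common point, not even an ideal one. -/
def Ultraparallel (C C' : ComplexGeodesic h) : Prop := Disjoint C.points C'.points

/-! For ultraparallel `C`, `C'` the following definitions describe the oriented segment of bisector
`B[C, C']` from `C` to `C'` and the corresponding oriented full bisector. -/

/-- The representative `q` of the polar point of `C'` (up to a positive factor) for which
`⟨C.vec, q⟩` is real and positive. -/
noncomputable def alignedVec (C C' : ComplexGeodesic h) : V := h C.vec C'.vec • C'.vec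

/-- The real plane on which the form is real and whose projectivization is the (extended) real
spine; the real spine contains the polar points of all slices. -/
noncomputable def realSpine (C C' : ComplexGeodesic h) : Submodule ℝ V :=
  Submodule.span ℝ {C.vec, alignedVec C C'}

/-- The complex line in `V` which represents the focus: the point polar to the complex spine. -/
noncomputable def focusLine (C C' : ComplexGeodesic h) : Submodule ℂ V :=
  LinearMap.ker (h.flip C.vec) ⊓ LinearMap.ker (h.flip C'.vec)

/-- The four-dimensional real space `W` such that the full bisector having `C` and `C'` as slices
is `ℙ W` (intersected with the closed ball): `ℙ W` is the projective cone over the real spine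
whose vertex is the focus. -/
noncomputable def bisectorSpace (C C' : ComplexGeodesic h) : Submodule ℝ V :=
  realSpine C C' ⊔ (focusLine C C').restrictScalars ℝ

/-- `M` is one of the slices from `C` to `C'`: its polar point lies on the arc of positive points of
the real spine between the polar points of `C` and `C'`. -/
def IsSliceBetween (C C' M : ComplexGeodesic h) : Prop :=
  ∃ v ∈ segment ℝ C.vec (alignedVec C C'), v ≠ 0 ∧ v ∈ M.polar.submodule

/-- The segment of bisector `B[C, C']`, formed by the slices from `C` to `C'`. -/
def bisectorSegment (C C' : ComplexGeodesic h) : Set (ℙ ℂ V) :=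
  {x | ∃ M : ComplexGeodesic h, IsSliceBetween C C' M ∧ x ∈ M.points}

/-- `M` is the middle slice of `B[C, C']`: the slice such that the reflection in it exchanges
`C` and `C'`. -/
def IsMiddleSlice (C C' M : ComplexGeodesic h) : Prop :=
  IsSliceBetween C C' M ∧ M.reflect '' C.points = C'.points ∧ M.reflect '' C'.points = C.points

end ComplexGeodesic

/-- The tangent space at `x` to `ℙ W`, for a real subspace `W` of `V`, inside the tangent space
`Hom(ℂ x, V / ℂ x)` to the projective plane: it is the image of the tangent space `W` to `W` at a
representative `v ∈ W` of `x`, i.e. it consists of all `φ` with `φ v ∈ (W + ℂ v) / ℂ v`. -/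
def tangentSpace (W : Submodule ℝ V) (x : ℙ ℂ V) :
    Submodule ℝ (x.submodule →ₗ[ℂ] V ⧸ x.submodule) where
  carrier := {φ | ∀ v : x.submodule, (v : V) ∈ W → ∃ w ∈ W, φ v = x.submodule.mkQ w}
  add_mem' := by
    intro φ ψ hφ hψ v hv
    obtain ⟨a, ha, ea⟩ := hφ v hv
    obtain ⟨b, hb, eb⟩ := hψ v hv
    exact ⟨a + b, W.add_mem ha hb, by rw [LinearMap.add_apply, ea, eb, map_add]⟩
  zero_mem' := fun v _ => ⟨0, W.zero_mem, by simp⟩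
  smul_mem' := by
    intro r φ hφ v hv
    obtain ⟨a, ha, ea⟩ := hφ v hv
    exact ⟨r • a, W.smul_mem r ha, by rw [LinearMap.smul_apply, ea]; rfl⟩

/-- The hypersurfaces `ℙ W` and `ℙ W'` are transversal at every point of `T`: their tangent spaces
together span the tangent space to the projective plane. -/
def TransversalAlong (W W' : Submodule ℝ V) (T : Set (ℙ ℂ V)) : Prop :=
  ∀ x ∈ T, tangentSpace W x ⊔ tangentSpace W' x = ⊤

namespace ComplexGeodesic

variable {h : V →ₗ[ℂ] V →ₗ⋆[ℂ] ℂ}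

/-- A representative `g` of the point in which `C` intersects the real spine of `B[C, C']`. The
oriented real spine (from `C` to `C'`) passes through this point as the curve `t ↦ g + t C.vec`. -/
noncomputable def spinePoint (C C' : ComplexGeodesic h) : V :=
  alignedVec C C' - (h (alignedVec C C') C.vec / h C.vec C.vec) • C.vec

/-- The normal vector to the oriented full bisector of `B[C, C']` at the point of `C` represented
by `v`, written as the value `φ v` of a tangent vector `φ` (it is orthogonal to `v`). If
`v = l g + y` with `g = spinePoint C C'` and `y` in the focus line, then `t ↦ l (g + t C.vec) + y`
runs in the bisector, orthogonally to the slice `C`, in the direction of the oriented real spine;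
multiplication by `i` turns its velocity `l C.vec` into the normal vector. -/
noncomputable def normalVec (C C' : ComplexGeodesic h) (v : V) : V :=
  (Complex.I * (h v (spinePoint C C') / h (spinePoint C C') (spinePoint C C'))) • C.vec

/-- The oriented angle, in `[0, 2π)`, from `B[C, M]` to `B[C, M']` at the point `s` of `C`: the
angle from the normal vector of the first to that of the second inside the complex line of tangent
vectors orthogonal to `C`. -/
noncomputable def orientedAngle (C M M' : ComplexGeodesic h) (s : ℙ ℂ V) : ℝ :=
  toIcoMod Real.two_pi_pos 0
    (Complex.arg (h (normalVec C M' s.rep) (normalVec C M s.rep)))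

/-- The closed half-space `K⁺` bounded by the oriented full bisector of `B[C, C']`: the side of the
normal vector. The bisector itself has the equation
`Im (⟨p, x⟩ ⟨x, q⟩ / ⟨p, q⟩) = 0`, where `p`, `q` are the polar points of `C`, `C'`. -/
def posHalfSpace (C C' : ComplexGeodesic h) : Set (ℙ ℂ V) :=
  {x | x ∈ closedBall h ∧ 0 ≤ (h C.vec x.rep * h x.rep C'.vec / h C.vec C'.vec).im}

/-- The closed half-space `K⁻` bounded by the oriented full bisector of `B[C, C']`. -/
def negHalfSpace (C C' : ComplexGeodesic h) : Set (ℙ ℂ V) :=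
  {x | x ∈ closedBall h ∧ (h C.vec x.rep * h x.rep C'.vec / h C.vec C'.vec).im ≤ 0}

open Classical in
/-- The sector from `B[C, M]` to `B[C, M']` (extended beyond `M` and `M'`), for full bisectors
transversal along `C`; it does not matter at which point of `C` the angle is measured. -/
noncomputable def sector (C M M' : ComplexGeodesic h) : Set (ℙ ℂ V) :=
  if ∃ s ∈ C.points ∩ openBall h, orientedAngle C M M' s ≤ Real.pi then
    posHalfSpace C M ∩ negHalfSpace C M'
  else
    posHalfSpace C M ∪ negHalfSpace C M'

open Classical in
/-- The interior sector at `C` of the triangle `Δ(C, M₁, M₂)`: among the sector from `B[C, M₁]` to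
`B[C, M₂]` and the sector from `B[C, M₂]` to `B[C, M₁]`, the one of angle less than `π`. -/
noncomputable def interiorSector (C M₁ M₂ : ComplexGeodesic h) : Set (ℙ ℂ V) :=
  if ∃ s ∈ C.points ∩ openBall h, orientedAngle C M₁ M₂ s < Real.pi then
    sector C M₁ M₂
  else
    sector C M₂ M₁

/-- The triangle `Δ(C, M₁, M₂)` of bisectors `B[C, M₁]`, `B[M₁, M₂]`, `B[M₂, C]`, for pairwise
ultraparallel `C`, `M₁`, `M₂`, is transversal: the full bisectors are transversal along their
common slices. -/
def IsTransversalTriangle (C M₁ M₂ : ComplexGeodesic h) : Prop :=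
  TransversalAlong (bisectorSpace C M₁) (bisectorSpace M₂ C) C.points ∧
  TransversalAlong (bisectorSpace C M₁) (bisectorSpace M₁ M₂) M₁.points ∧
  TransversalAlong (bisectorSpace M₁ M₂) (bisectorSpace M₂ C) M₂.points

/-- The (transversal) triangle `Δ(S, M₂, M₁)` is transversally adjacent to the (transversal)
triangle `Δ(C, M₁, M₂)`. -/
def IsTransversallyAdjacent (S M₂ M₁ C : ComplexGeodesic h) : Prop :=
  (S.points ∩ interiorSector C M₁ M₂).Nonempty ∧
  TransversalAlong (bisectorSpace C M₁) (bisectorSpace M₁ S) M₁.points ∧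
  TransversalAlong (bisectorSpace M₂ C) (bisectorSpace S M₂) M₂.points

end ComplexGeodesic

open ComplexGeodesic

/-- A configuration of bisectors `B_i = B[S_i, S_{i+1}]`, the indices being modulo `n`. -/
structure Configuration (h : V →ₗ[ℂ] V →ₗ⋆[ℂ] ℂ) (n : ℕ) where
  S : ZMod n → ComplexGeodesic h
  ultraparallel : ∀ i, Ultraparallel (S i) (S (i + 1))

namespace Configuration

variable {h : V →ₗ[ℂ] V →ₗ⋆[ℂ] ℂ} {n : ℕ}

/-- The segment of bisector `B_i`. -/
def B (K : Configuration h n) (i : ZMod n) : Set (ℙ ℂ V) := bisectorSegment (K.S i) (K.S (i + 1))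

/-- A simple configuration: no intersections of the segments besides the obvious ones. -/
def IsSimple (K : Configuration h n) : Prop :=
  (∀ i j, (K.B i ∩ K.B j).Nonempty → j = i - 1 ∨ j = i ∨ j = i + 1) ∧
  ∀ i, K.B (i - 1) ∩ K.B i = (K.S i).points

/-- A transversal configuration. -/
def IsTransversal (K : Configuration h n) : Prop :=
  ∀ i, K.B (i - 1) ∩ K.B i = (K.S i).points ∧
    TransversalAlong (bisectorSpace (K.S (i - 1)) (K.S i)) (bisectorSpace (K.S i) (K.S (i + 1)))
      (K.S i).points

/-- `M i` is the middle slice of `B_i`, for every `i`. -/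
def AreMiddleSlices (K : Configuration h n) (M : ZMod n → ComplexGeodesic h) : Prop :=
  ∀ i, IsMiddleSlice (K.S i) (K.S (i + 1)) (M i)

end Configuration

/-- `C` is a centre of a configuration of bisectors with the middle slices `M i`. -/
def IsCentre {h : V →ₗ[ℂ] V →ₗ⋆[ℂ] ℂ} {n : ℕ} (M : ZMod n → ComplexGeodesic h)
    (C : ComplexGeodesic h) : Prop :=
  (∀ i, Ultraparallel C (M i)) ∧
  ∀ i, TransversalAlong (bisectorSpace C (M (i - 1))) (bisectorSpace C (M i)) C.points

/-- The central angle at the point `c` of `C`: the sum of the oriented angles from `B[C, M_{i-1}]`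
to `B[C, M_i]`. -/
noncomputable def centralAngle {h : V →ₗ[ℂ] V →ₗ⋆[ℂ] ℂ} {n : ℕ} [NeZero n]
    (M : ZMod n → ComplexGeodesic h) (C : ComplexGeodesic h) (c : ℙ ℂ V) : ℝ :=
  ∑ i, orientedAngle C (M (i - 1)) (M i) c

end

end ComplexHyperbolic

/-! Let `p` be the polar vector of the centre. A nonpositive vector splits as `x = α p + v` with `v`
on the slice `C`, and by `side_decomp` the position of `x` relative to the bisector from `C` to `M
i` is the sign of the imaginary part of `conj α * d i`, where `d i` is the `dirCoord` of `M i` at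
`v`. Over a fixed `v` the bisectors through `C` thus become the rays `d i` in the complex plane, and
`x` becomes the number `-α`.

Transversality and the bound `π` make each ray turn from the preceding one by an angle strictly
between `0` and `π` (`turns_of_orientedAngle_le`). The total turning is a multiple of `2π` that
varies continuously with `v`, so it is `2π` over every point of `C` once it is so over one
(`sum_arg_eq`). Hence the sectors between consecutive rays cover the punctured plane exactly once
(`sector_unique`).

The slice `M k` cuts `B k` into two halves. By transversal adjacency the half towards `S k` stays in
the sector from `M (k - 1)` to `M k`, the other half in the next one (`segment_subset_sector`,
`onSegment_sides`). A point of `B k` therefore has `-α` strictly between `d (k - 1)` and `d (k +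
1)`, and two such double sectors meet only for neighbouring indices (`double_sector_inter`). The
other clause of simplicity is contained in the transversality of the configuration.

The containment of the halves is a calculus of signs. Two nowhere tangent bisectors with a common
slice have a constant orientation (`NonTangent.turns`). It determines the side on which segments
leaving that slice lie (`Turns.side_pos`) and is determined by the side of a single point
(`NonTangent.turns_of_side`). In this way signs pass from vertex to vertex of the triangles, and
`cone_side` concludes. -/

namespace ComplexHyperbolic

open ComplexGeodesic

/-! ### Slice vectors and the orientation of angles along a slice. -/

section Vectors

variable {V : Type*} [AddCommGroup V] [Module ℂ V] (h : V →ₗ[ℂ] V →ₗ⋆[ℂ] ℂ)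

/-- The nonpositive vectors representing the points of the complex geodesic polar to `a`. -/
def IsSliceVec (a v : V) : Prop := v ≠ 0 ∧ h v a = 0 ∧ (h v v).re ≤ 0

/-- Up to a negative factor, the coordinate of the direction from the slice polar to `a` to the
slice polar to `b` over the point `v`. -/
def dirCoord (a b v : V) : ℂ := h v b * h b a

/-- The defining function of the full bisector having the slices polar to `a` and `b`. -/
def side (a b x : V) : ℝ := (h a x * h x b * h b a).im

/-- The bisectors from `a` to `b` and from `a` to `c` form an angle whose orientation is prescribed
by the sign of `ε`, at all points of the slice polar to `a`. -/
def Turns (ε : ℝ) (a b c : V) : Prop :=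
  ∀ v, IsSliceVec h a v → 0 < ε * (dirCoord h a b v * (starRingEnd ℂ) (dirCoord h a c v)).im

/-- The bisectors from `a` to `b` and from `a` to `c` form a nondegenerate angle everywhere. -/
def NonTangent (a b c : V) : Prop :=
  ∀ v, IsSliceVec h a v → (dirCoord h a b v * (starRingEnd ℂ) (dirCoord h a c v)).im ≠ 0

variable {h}

theorem dirCoord_smul (a b v : V) (r : ℂ) : dirCoord h a b (r • v) = r * dirCoord h a b v := by
  simp [dirCoord, mul_assoc]

theorem dirCoord_add (a b v w : V) :
    dirCoord h a b (v + w) = dirCoord h a b v + dirCoord h a b w := by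
  simp [dirCoord, add_mul]

theorem im_mul_conj_swap (z w : ℂ) :
    (w * (starRingEnd ℂ) z).im = -(z * (starRingEnd ℂ) w).im := by
  simp only [Complex.mul_im, Complex.conj_re, Complex.conj_im]
  ring

theorem Turns.swap {ε : ℝ} {a b c : V} (ht : Turns h ε a b c) : Turns h (-ε) a c b := by
  intro v hv
  have := ht v hv
  rw [im_mul_conj_swap]
  linarith

theorem NonTangent.swap {a b c : V} (ht : NonTangent h a b c) : NonTangent h a c b := by
  intro v hv h0
  rw [im_mul_conj_swap] at h0
  exact ht v hv (by linarith)

theorem IsSliceVec.smul {a v : V} (hv : IsSliceVec h a v) {r : ℂ} (hr : r ≠ 0) :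
    IsSliceVec h a (r • v) := by
  refine ⟨smul_ne_zero hr hv.1, by simp [hv.2.1], ?_⟩
  have e : (h (r • v) (r • v)).re = Complex.normSq r * (h v v).re := by
    simp [Complex.normSq_apply]
    ring
  rw [e]
  exact mul_nonpos_of_nonneg_of_nonpos (Complex.normSq_nonneg r) hv.2.2

/-- Any two slice vectors are joined, up to a nonzero factor of the first one, by a line segment
of slice vectors. -/
theorem IsSliceVec.exists_segment (hs : ∀ x y : V, h y x = (starRingEnd ℂ) (h x y)) {a v w : V}
    (hv : IsSliceVec h a v) (hw : IsSliceVec h a w) :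
    ∃ r : ℂ, r ≠ 0 ∧ ∀ t ∈ Set.Icc (0 : ℝ) 1,
      IsSliceVec h a (((1 - t : ℝ) : ℂ) • (r • v) + (t : ℂ) • w) := by
  by_cases hd : ∃ k : ℂ, w = k • v
  · obtain ⟨k, rfl⟩ := hd
    have hk : k ≠ 0 := by
      rintro rfl
      exact hw.1 (by simp)
    refine ⟨k, hk, fun t _ => ?_⟩
    have e : ((1 - t : ℝ) : ℂ) • (k • v) + (t : ℂ) • (k • v) = k • v := by
      rw [← add_smul]
      simp
    rw [e]
    exact hw
  · obtain ⟨r, hr, hre⟩ : ∃ r : ℂ, r ≠ 0 ∧ (r * h v w).re ≤ 0 := by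
      by_cases hz : h v w = 0
      · exact ⟨1, one_ne_zero, by simp [hz]⟩
      -- This phase makes the mixed term of the form nonpositive along the whole segment.
      · refine ⟨-(starRingEnd ℂ) (h v w), by simpa using hz, ?_⟩
        rw [neg_mul, mul_comm, Complex.mul_conj]
        simpa using Complex.normSq_nonneg _
    refine ⟨r, hr, fun t ht => ⟨?_, by simp [hv.2.1, hw.2.1], ?_⟩⟩
    · intro h0
      by_cases ht0 : t = 0
      · subst ht0
        simp [hr, hv.1] at h0
      · apply hd
        have htc : (t : ℂ) ≠ 0 := by exact_mod_cast ht0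
        refine ⟨-((t : ℂ)⁻¹ * ((1 - t : ℝ) : ℂ) * r), ?_⟩
        have h1 : (t : ℂ) • w = -(((1 - t : ℝ) : ℂ) • (r • v)) := (neg_eq_of_add_eq_zero_right h0).symm
        calc w = (t : ℂ)⁻¹ • ((t : ℂ) • w) := by rw [smul_smul, inv_mul_cancel₀ htc, one_smul]
          _ = _ := by rw [h1, smul_neg, neg_smul, smul_smul, smul_smul]
    · have e : (h (((1 - t : ℝ) : ℂ) • (r • v) + (t : ℂ) • w)
          (((1 - t : ℝ) : ℂ) • (r • v) + (t : ℂ) • w)).re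
          = (1 - t) ^ 2 * (h (r • v) (r • v)).re + t ^ 2 * (h w w).re
            + 2 * t * (1 - t) * (r * h v w).re := by
        simp only [map_add, LinearMap.add_apply, map_smul, LinearMap.smul_apply,
          map_smulₛₗ, smul_eq_mul, hs v w, Complex.conj_ofReal]
        simp only [Complex.add_re, Complex.add_im, Complex.mul_re, Complex.mul_im,
          Complex.ofReal_re, Complex.ofReal_im, Complex.conj_re, Complex.conj_im]
        ring
      rw [e]
      have h1 := (hv.smul hr).2.2
      have h2 := hw.2.2
      have h3 : 0 ≤ 2 * t * (1 - t) := by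
        have := ht.1
        have := ht.2
        have : 0 ≤ t * (1 - t) := mul_nonneg ht.1 (by linarith)
        linarith
      have := mul_nonpos_of_nonneg_of_nonpos (sq_nonneg (1 - t)) h1
      have := mul_nonpos_of_nonneg_of_nonpos (sq_nonneg t) h2
      have := mul_nonpos_of_nonneg_of_nonpos h3 hre
      linarith

theorem continuous_dirCoord_segment (a b v w : V) :
    Continuous fun t : ℝ => dirCoord h a b (((1 - t : ℝ) : ℂ) • v + (t : ℂ) • w) := by
  simp only [dirCoord_add, dirCoord_smul]
  fun_prop

/-- A change of sign would produce a zero on a segment of slice vectors by the intermediate value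
theorem; the rescaling by `r` multiplies the imaginary part by the positive number `|r|²`. -/
theorem NonTangent.turns (hs : ∀ x y : V, h y x = (starRingEnd ℂ) (h x y)) {a b c : V}
    (ht : NonTangent h a b c) : Turns h 1 a b c ∨ Turns h (-1) a b c := by
  by_contra hcon
  simp only [Turns, not_or, not_forall, not_lt] at hcon
  obtain ⟨⟨v, hv, hv1⟩, w, hw, hw1⟩ := hcon
  obtain ⟨r, hr, hseg⟩ := hv.exists_segment hs hw
  set f : ℝ → ℝ := fun t =>
    (dirCoord h a b (((1 - t : ℝ) : ℂ) • (r • v) + (t : ℂ) • w) *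
      (starRingEnd ℂ) (dirCoord h a c (((1 - t : ℝ) : ℂ) • (r • v) + (t : ℂ) • w))).im with hf
  have hcont : Continuous f := Complex.continuous_im.comp
    ((continuous_dirCoord_segment a b _ _).mul
      (Complex.continuous_conj.comp (continuous_dirCoord_segment a c _ _)))
  have h0 : f 0 ≤ 0 := by
    have e : f 0 = Complex.normSq r *
        (dirCoord h a b v * (starRingEnd ℂ) (dirCoord h a c v)).im := by
      simp [hf, dirCoord_smul, Complex.normSq_apply]
      ring
    rw [e]
    exact mul_nonpos_of_nonneg_of_nonpos (Complex.normSq_nonneg r) (by linarith)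
  have h1 : 0 ≤ f 1 := by
    have e : f 1 = (dirCoord h a b w * (starRingEnd ℂ) (dirCoord h a c w)).im := by
      simp [hf]
    rw [e]
    linarith
  obtain ⟨t, ht1, ht2⟩ := intermediate_value_Icc zero_le_one hcont.continuousOn ⟨h0, h1⟩
  exact ht _ (hseg t ht1) ht2

theorem Turns.eq_sign {a b c v : V} {ε : ℝ} (hs : ∀ x y : V, h y x = (starRingEnd ℂ) (h x y))
    (ht : NonTangent h a b c) (hv : IsSliceVec h a v)
    (hpos : 0 ≤ ε * (dirCoord h a b v * (starRingEnd ℂ) (dirCoord h a c v)).im)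
    (hε : ε = 1 ∨ ε = -1) : Turns h ε a b c := by
  have h0 := ht v hv
  rcases ht.turns hs with h1 | h1 <;> rcases hε with rfl | rfl
  · exact h1
  · have := h1 v hv
    exact absurd (by linarith) h0
  · have := h1 v hv
    exact absurd (by linarith) h0
  · exact h1

/-! ### Orthogonal decomposition and sides of a bisector. -/

theorem self_eq_ofReal (hs : ∀ x y : V, h y x = (starRingEnd ℂ) (h x y)) (a : V) :
    h a a = ((h a a).re : ℂ) :=
  (Complex.conj_eq_iff_re.mp (hs a a).symm).symm

/-- The orthogonal decomposition of a nonpositive vector with respect to a positive one. -/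
theorem exists_decomp (hs : ∀ x y : V, h y x = (starRingEnd ℂ) (h x y)) {a x : V}
    (ha : 0 < (h a a).re) (hx0 : x ≠ 0) (hx : (h x x).re ≤ 0) :
    ∃ (α : ℂ) (v : V), x = α • a + v ∧ IsSliceVec h a v := by
  have ha0 : h a a ≠ 0 := by
    intro h0
    simp [h0] at ha
  set α := h x a / h a a with hα
  set v := x - α • a with hv
  have hxe : x = α • a + v := by
    rw [hv]
    abel
  have hva : h v a = 0 := by
    rw [hv]
    simp only [map_sub, LinearMap.sub_apply, map_smul, LinearMap.smul_apply, smul_eq_mul, hα]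
    field_simp
    ring
  have hav : h a v = 0 := by rw [hs v a, hva, map_zero]
  have e : (h x x).re = Complex.normSq α * (h a a).re + (h v v).re := by
    rw [hxe]
    simp only [map_add, LinearMap.add_apply, map_smul, LinearMap.smul_apply, map_smulₛₗ,
      smul_eq_mul, hva, hav, mul_zero, add_zero, zero_add]
    rw [self_eq_ofReal hs a]
    simp [Complex.normSq_apply]
    ring
  have hn := mul_nonneg (Complex.normSq_nonneg α) ha.le
  refine ⟨α, v, hxe, ?_, hva, by linarith⟩
  intro h0
  rw [h0] at hxe e
  simp only [map_zero, Complex.zero_re, add_zero] at e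
  have : Complex.normSq α = 0 := by
    by_contra hne
    have : 0 < Complex.normSq α * (h a a).re :=
      mul_pos (lt_of_le_of_ne (Complex.normSq_nonneg α) (Ne.symm hne)) ha
    linarith
  rw [Complex.normSq_eq_zero] at this
  apply hx0
  rw [hxe, this]
  simp

theorem side_swap (hs : ∀ x y : V, h y x = (starRingEnd ℂ) (h x y)) (a b x : V) :
    side h b a x = -side h a b x := by
  have : h b x * h x a * h a b = (starRingEnd ℂ) (h a x * h x b * h b a) := by
    rw [map_mul, map_mul, ← hs a x, ← hs x b, ← hs b a]
    ring
  rw [side, this, Complex.conj_im, side]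

/-- The contribution of `α a` to the triple product is real, so only the cross term with `v`
survives. This reduces the side of a bisector to plane geometry of `α` and one ray. -/
theorem side_decomp (hs : ∀ x y : V, h y x = (starRingEnd ℂ) (h x y)) {a v : V}
    (hva : h v a = 0) (b : V) (α : ℂ) :
    side h a b (α • a + v) = (h a a).re * ((starRingEnd ℂ) α * dirCoord h a b v).im := by
  have hav : h a v = 0 := by rw [hs v a, hva, map_zero]
  have e : h a (α • a + v) * h (α • a + v) b * h b a =
      ((h a a).re : ℂ) * ((starRingEnd ℂ) α * dirCoord h a b v) +
        (((h a a).re * Complex.normSq α * Complex.normSq (h a b) : ℝ) : ℂ) := by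
    simp only [map_add, LinearMap.add_apply, map_smul, LinearMap.smul_apply, map_smulₛₗ,
      smul_eq_mul, hav, add_zero, dirCoord, Complex.ofReal_mul, ← Complex.mul_conj]
    rw [← hs a b, ← self_eq_ofReal hs a]
    ring
  rw [side, e, Complex.add_im, Complex.ofReal_im, Complex.im_ofReal_mul, add_zero]

/-- The slices from the one polar to `a` to the one polar to `b` lie, except for the first one, on
the side of the bisector from `a` to `c` prescribed by the angle at `a`. -/
theorem Turns.side_pos (hs : ∀ x y : V, h y x = (starRingEnd ℂ) (h x y)) {a b c x : V} {ε ρ σ : ℝ}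
    (ht : Turns h ε a b c) (ha : 0 < (h a a).re) (hab : h a b ≠ 0) (hx0 : x ≠ 0)
    (hx : (h x x).re ≤ 0) (hρ : 0 ≤ ρ) (hσ : 0 < σ)
    (hslice : (ρ : ℂ) * h x a + σ * dirCoord h a b x = 0) : 0 < ε * side h a c x := by
  obtain ⟨α, v, rfl, hv⟩ := exists_decomp hs ha hx0 hx
  rw [side_decomp hs hv.2.1]
  -- The slice equation becomes `P α = -σ d` with `d` the coordinate of `b` at `v`: `α` is a
  -- negative multiple of `d`.
  set P : ℝ := ρ * (h a a).re + σ * Complex.normSq (h a b) with hP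
  have hPpos : 0 < P := by
    have h1 : 0 ≤ ρ * (h a a).re := mul_nonneg hρ ha.le
    have h2 : 0 < σ * Complex.normSq (h a b) := mul_pos hσ (Complex.normSq_pos.mpr hab)
    linarith
  have e1 : (P : ℂ) * α = -σ * dirCoord h a b v := by
    have e2 : (ρ : ℂ) * h (α • a + v) a + σ * dirCoord h a b (α • a + v) =
        (P : ℂ) * α + σ * dirCoord h a b v := by
      simp only [map_add, LinearMap.add_apply, map_smul, LinearMap.smul_apply, smul_eq_mul,
        hv.2.1, add_zero, dirCoord, hP, Complex.ofReal_add, Complex.ofReal_mul,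
        ← Complex.mul_conj]
      rw [← hs a b, ← self_eq_ofReal hs a]
      ring
    rw [hslice] at e2
    linear_combination -e2
  have e3 : (P : ℂ) * ((starRingEnd ℂ) α * dirCoord h a c v) =
      -(σ : ℂ) * ((starRingEnd ℂ) (dirCoord h a b v) * dirCoord h a c v) := by
    have := congrArg (starRingEnd ℂ) e1
    simp only [map_mul, map_neg, Complex.conj_ofReal] at this
    linear_combination dirCoord h a c v * this
  have e4 : P * ((starRingEnd ℂ) α * dirCoord h a c v).im =
      σ * (dirCoord h a b v * (starRingEnd ℂ) (dirCoord h a c v)).im := by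
    have := congrArg Complex.im e3
    rw [← Complex.ofReal_neg, Complex.im_ofReal_mul, Complex.im_ofReal_mul] at this
    rw [this, im_mul_conj_swap, mul_comm (dirCoord h a c v)]
    ring
  have h1 := mul_pos hσ (ht v hv)
  have h2 : 0 < P * (ε * ((starRingEnd ℂ) α * dirCoord h a c v).im) := by
    calc 0 < _ := h1
      _ = ε * (σ * (dirCoord h a b v * (starRingEnd ℂ) (dirCoord h a c v)).im) := by ring
      _ = _ := by rw [← e4]; ring
  have h3 := mul_pos ha (pos_of_mul_pos_right h2 hPpos.le)
  linarith

theorem Turns.side_pos_of_isSliceVec (hs : ∀ x y : V, h y x = (starRingEnd ℂ) (h x y))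
    {a b c x : V} {ε : ℝ} (ht : Turns h ε a b c) (ha : 0 < (h a a).re) (hab : h a b ≠ 0)
    (hx : IsSliceVec h b x) : 0 < ε * side h a c x :=
  ht.side_pos hs ha hab hx.1 hx.2.2 le_rfl one_pos (by simp [dirCoord, hx.2.1])

/-- The whole slice of `b` lies strictly on the side given by the orientation at `a`, so one of its
points already reveals that orientation. -/
theorem NonTangent.turns_of_side (hs : ∀ x y : V, h y x = (starRingEnd ℂ) (h x y))
    {a b c x : V} {ε : ℝ} (ht : NonTangent h a b c) (ha : 0 < (h a a).re) (hab : h a b ≠ 0)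
    (hx : IsSliceVec h b x) (hε : ε = 1 ∨ ε = -1) (hside : 0 ≤ ε * side h a c x) :
    Turns h ε a b c := by
  rcases ht.turns hs with h1 | h1 <;> rcases hε with rfl | rfl
  · exact h1
  · have := h1.side_pos_of_isSliceVec hs ha hab hx
    linarith
  · have := h1.side_pos_of_isSliceVec hs ha hab hx
    linarith
  · exact h1

/-! ### Segments that stay in a sector. -/

/-- If `-α` lies in the open cone spanned by `d₁` and `d₂` and these are on one side of the real
line spanned by `d`, then `-α` is on the same side. -/
theorem cone_side {α d₁ d₂ d : ℂ} {ε κ : ℝ}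
    (h₁₂ : 0 < κ * (d₁ * (starRingEnd ℂ) d₂).im)
    (hα₂ : 0 < κ * ((starRingEnd ℂ) α * d₂).im)
    (hα₁ : 0 < -κ * ((starRingEnd ℂ) α * d₁).im)
    (h₁ : 0 < ε * (d₁ * (starRingEnd ℂ) d).im) (h₂ : 0 < ε * (d₂ * (starRingEnd ℂ) d).im) :
    0 < ε * ((starRingEnd ℂ) α * d).im := by
  have key : (κ * (d₁ * (starRingEnd ℂ) d₂).im) * (ε * ((starRingEnd ℂ) α * d).im) =
      (κ * ((starRingEnd ℂ) α * d₂).im) * (ε * (d₁ * (starRingEnd ℂ) d).im) +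
        (-κ * ((starRingEnd ℂ) α * d₁).im) * (ε * (d₂ * (starRingEnd ℂ) d).im) := by
    simp only [Complex.mul_im, Complex.conj_re, Complex.conj_im]
    ring
  have : 0 < (κ * (d₁ * (starRingEnd ℂ) d₂).im) * (ε * ((starRingEnd ℂ) α * d).im) := by
    rw [key]
    exact add_pos (mul_pos hα₂ h₁) (mul_pos hα₁ h₂)
  exact pos_of_mul_pos_right this h₁₂.le

/-- The segment of bisector from `q₁` to `s` stays in the sector at `p` from `q₁` to `q₂`. -/
theorem segment_subset_sector (hs : ∀ x y : V, h y x = (starRingEnd ℂ) (h x y))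
    (hneg : ∃ e, (h e e).re < 0) {p q₁ q₂ s x x₀ : V} {ε ρ σ : ℝ} (hε : ε = 1 ∨ ε = -1)
    (hp : 0 < (h p p).re) (hq₁ : 0 < (h q₁ q₁).re) (hq₂ : 0 < (h q₂ q₂).re)
    (hss : 0 < (h s s).re) (hpq₁ : h p q₁ ≠ 0) (hqq : h q₂ q₁ ≠ 0) (hq₁s : h q₁ s ≠ 0)
    (hq₂s : h q₂ s ≠ 0) (hturn : Turns h ε p q₁ q₂) (nt₁ : NonTangent h q₂ q₁ p)
    (nt₂ : NonTangent h q₂ s p) (nt₃ : NonTangent h q₁ s p) (nt₄ : NonTangent h q₂ q₁ s)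
    (nt₅ : NonTangent h s q₁ q₂) (nt₆ : NonTangent h q₁ s q₂) (hx₀ : IsSliceVec h s x₀)
    (h₁ : 0 ≤ -ε * side h p q₁ x₀) (h₂ : 0 ≤ ε * side h p q₂ x₀)
    (hx0 : x ≠ 0) (hx : (h x x).re ≤ 0) (hρ : 0 ≤ ρ) (hσ : 0 ≤ σ) (hρσ : ρ ≠ 0 ∨ σ ≠ 0)
    (hslice : (ρ : ℂ) * h x q₁ + σ * dirCoord h q₁ s x = 0) :
    0 < ε * side h p q₂ x ∧ 0 ≤ -ε * side h p q₁ x := by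
  have hε' : -ε = 1 ∨ -ε = -1 := by
    rcases hε with rfl | rfl <;> simp
  have hsq₁ : h s q₁ ≠ 0 := by
    rw [hs q₁ s]
    simpa using hq₁s
  -- The single point `x₀` of the slice of `s` inside the sector fixes how the bisectors to `s`
  -- leave `q₂` and `q₁`.
  have t₂ : Turns h (-ε) q₂ s p := by
    refine nt₂.turns_of_side hs hq₂ hq₂s hx₀ hε' ?_
    rw [side_swap hs p q₂]
    linarith
  have t₃ : Turns h ε q₁ s p := by
    refine nt₃.turns_of_side hs hq₁ hq₁s hx₀ hε ?_
    rw [side_swap hs p q₁]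
    linarith
  have hM : ∀ y, IsSliceVec h q₁ y → 0 < ε * side h p q₂ y := fun y hy =>
    hturn.side_pos_of_isSliceVec hs hp hpq₁ hy
  rcases hσ.eq_or_lt with hσ0 | hσ0
  · subst hσ0
    have hρ0 : (ρ : ℂ) ≠ 0 := by
      have : ρ ≠ 0 := by simpa using hρσ
      exact_mod_cast this
    have hxq : h x q₁ = 0 := by simpa [hρ0] using hslice
    refine ⟨hM x ⟨hx0, hxq, hx⟩, ?_⟩
    simp [side, hxq]
  have hq₁x : 0 < -ε * side h p q₁ x := by
    have := t₃.side_pos hs hq₁ hq₁s hx0 hx hρ hσ0 hslice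
    rw [side_swap hs p q₁] at this
    linarith
  refine ⟨?_, hq₁x.le⟩
  rcases hρ.eq_or_lt with hρ0 | hρ0
  · subst hρ0
    have hxs : h x s = 0 := by simpa [hσ0.ne', dirCoord, hsq₁] using hslice
    have := t₂.side_pos_of_isSliceVec hs hq₂ hq₂s ⟨hx0, hxs, hx⟩
    rw [side_swap hs p q₂] at this
    linarith
  obtain ⟨e, he⟩ := hneg
  obtain ⟨-, m, -, hm⟩ := exists_decomp hs hq₁ (x := e) (by rintro rfl; simp at he) he.le
  have t₁ : Turns h (-ε) q₂ q₁ p := by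
    refine nt₁.turns_of_side hs hq₂ hqq hm hε' ?_
    have := hM m hm
    rw [side_swap hs p q₂]
    linarith
  -- The orientation `κ` of the triangle `q₂`, `q₁`, `s` is not prescribed; it is carried to the
  -- vertices `s` and `q₁` to place `x` inside the angle at `q₂`.
  obtain ⟨κ, hκ, t₄⟩ : ∃ κ : ℝ, (κ = 1 ∨ κ = -1) ∧ Turns h κ q₂ q₁ s := by
    rcases nt₄.turns hs with h1 | h1
    exacts [⟨1, Or.inl rfl, h1⟩, ⟨-1, Or.inr rfl, h1⟩]
  have hκ' : -κ = 1 ∨ -κ = -1 := by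
    rcases hκ with rfl | rfl <;> simp
  have hxs : 0 < κ * side h q₂ s x := by
    have t₅ : Turns h (-κ) s q₁ q₂ := by
      refine nt₅.turns_of_side hs hss hsq₁ hm hκ' ?_
      have := t₄.side_pos_of_isSliceVec hs hq₂ hqq hm
      rw [side_swap hs q₂ s]
      linarith
    -- The same slice read from the other end: the slice equation multiplied by `h q₁ s` has `s` as
    -- its base vector.
    have := t₅.side_pos hs hss hsq₁ hx0 hx (ρ := σ * Complex.normSq (h q₁ s))
      (mul_nonneg hσ (Complex.normSq_nonneg _)) hρ0 (by
        rw [Complex.ofReal_mul, ← Complex.mul_conj, ← hs q₁ s]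
        simp only [dirCoord] at hslice ⊢
        linear_combination h q₁ s * hslice)
    rw [side_swap hs q₂ s] at this
    linarith
  have hxq : 0 < -κ * side h q₂ q₁ x := by
    have t₆ : Turns h κ q₁ s q₂ := by
      refine nt₆.turns_of_side hs hq₁ hq₁s hx₀ hκ ?_
      have := t₄.swap.side_pos_of_isSliceVec hs hq₂ hq₂s hx₀
      rw [side_swap hs q₂ q₁]
      linarith
    have := t₆.side_pos hs hq₁ hq₁s hx0 hx hρ hσ0 hslice
    rw [side_swap hs q₂ q₁] at this
    linarith
  -- Seen from `q₂`, the number `-α` lies between the directions to `q₁` and to `s`, which are both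
  -- on the same side of the direction to `p`.
  have hgoal : 0 < -ε * side h q₂ p x := by
    obtain ⟨α, v, rfl, hv⟩ := exists_decomp hs hq₂ hx0 hx
    rw [side_decomp hs hv.2.1] at hxs hxq ⊢
    rw [mul_left_comm] at hxs hxq ⊢
    exact mul_pos hq₂ (cone_side (t₄ v hv) (pos_of_mul_pos_right hxs hq₂.le)
      (pos_of_mul_pos_right hxq hq₂.le) (t₁ v hv) (t₂ v hv))
  rw [side_swap hs p q₂] at hgoal
  linarith

/-! ### Disjoint slices and the real spine. -/

/-- The slices polar to `a` and `b` have no common point. -/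
def Apart (h : V →ₗ[ℂ] V →ₗ⋆[ℂ] ℂ) (a b : V) : Prop := ∀ v, IsSliceVec h a v → h v b ≠ 0

/-- The point of the spine orthogonal to `a`. -/
noncomputable def spineVec (h : V →ₗ[ℂ] V →ₗ⋆[ℂ] ℂ) (a b : V) : V :=
  h a b • b - (h (h a b • b) a / h a a) • a

theorem ne_zero_of_re_pos {a : V} (ha : 0 < (h a a).re) : h a a ≠ 0 := by
  intro h0
  simp [h0] at ha

theorem spineVec_orthogonal {a : V} (ha : 0 < (h a a).re) (b : V) :
    h (spineVec h a b) a = 0 := by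
  have := ne_zero_of_re_pos ha
  simp only [spineVec, map_sub, LinearMap.sub_apply, map_smul, LinearMap.smul_apply, smul_eq_mul]
  field_simp
  ring

theorem apply_spineVec (hs : ∀ x y : V, h y x = (starRingEnd ℂ) (h x y)) {a v : V}
    (hva : h v a = 0) (b : V) : h v (spineVec h a b) = dirCoord h a b v := by
  simp only [spineVec, map_sub, map_smulₛₗ, smul_eq_mul, hva, mul_zero, sub_zero, dirCoord,
    ← hs a b]
  ring

/-- Removing the components along `a` and `b` from a negative vector leaves a nonpositive one. Hence
disjoint slices never have orthogonal polar vectors. -/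
theorem exists_decomp_pair (hs : ∀ x y : V, h y x = (starRingEnd ℂ) (h x y)) {a b : V}
    (ha : 0 < (h a a).re) (hb : 0 < (h b b).re) (hab : h a b = 0) (hneg : ∃ e, (h e e).re < 0) :
    ∃ v, IsSliceVec h a v ∧ h v b = 0 := by
  obtain ⟨e, he⟩ := hneg
  obtain ⟨α, v, rfl, hv⟩ := exists_decomp hs ha (x := e) (by rintro rfl; simp at he) he.le
  obtain ⟨β, w, rfl, hw⟩ := exists_decomp hs hb hv.1 hv.2.2
  refine ⟨w, ⟨hw.1, ?_, hw.2.2⟩, hw.2.1⟩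
  have hba : h b a = 0 := by rw [hs a b, hab, map_zero]
  simpa [hba] using hv.2.1

theorem Apart.apply_ne_zero (hs : ∀ x y : V, h y x = (starRingEnd ℂ) (h x y)) {a b : V}
    (hap : Apart h a b) (ha : 0 < (h a a).re) (hb : 0 < (h b b).re)
    (hneg : ∃ e, (h e e).re < 0) : h a b ≠ 0 := by
  intro hab
  obtain ⟨v, hv, hv'⟩ := exists_decomp_pair hs ha hb hab hneg
  exact hap v hv hv'

theorem Apart.symm {a b : V} (hap : Apart h a b) : Apart h b a :=
  fun v hv hva => hap v ⟨hv.1, hva, hv.2.2⟩ hv.2.1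

theorem Apart.dirCoord_ne_zero (hs : ∀ x y : V, h y x = (starRingEnd ℂ) (h x y)) {a b v : V}
    (hap : Apart h a b) (ha : 0 < (h a a).re) (hb : 0 < (h b b).re)
    (hneg : ∃ e, (h e e).re < 0) (hv : IsSliceVec h a v) : dirCoord h a b v ≠ 0 := by
  refine mul_ne_zero (hap v hv) ?_
  rw [hs a b]
  simpa using hap.apply_ne_zero hs ha hb hneg

/-- On the slice of `a`, orthogonality to the spine vector `g` amounts to orthogonality to `b`. If
`g` were zero, null or positive, then any slice vector, `g` itself, or a nonpositive vector
orthogonal to both `a` and `g`, respectively, would lie on both slices. -/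
theorem Apart.spineVec_neg (hs : ∀ x y : V, h y x = (starRingEnd ℂ) (h x y)) {a b : V}
    (hap : Apart h a b) (ha : 0 < (h a a).re) (hb : 0 < (h b b).re)
    (hneg : ∃ e, (h e e).re < 0) : (h (spineVec h a b) (spineVec h a b)).re < 0 := by
  have hab := hap.apply_ne_zero hs ha hb hneg
  have hga := spineVec_orthogonal ha b
  set g := spineVec h a b with hg
  have hba : h b a ≠ 0 := by
    rw [hs a b]
    simpa using hab
  have hgb : ∀ v, h v a = 0 → h v g = 0 → h v b = 0 := by
    intro v hva hvg
    rw [hg, apply_spineVec hs hva] at hvg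
    exact (mul_eq_zero.mp hvg).resolve_right hba
  by_contra hcon
  rcases (not_lt.mp hcon).eq_or_lt with h0 | h0
  · have hgg : h g g = 0 := by
      rw [self_eq_ofReal hs g, ← h0, Complex.ofReal_zero]
    by_cases hg0 : g = 0
    · obtain ⟨e, he⟩ := hneg
      obtain ⟨α, v, -, hv⟩ := exists_decomp hs ha (x := e) (by rintro rfl; simp at he) he.le
      exact hap v hv (hgb v hv.2.1 (by simp [hg0]))
    · exact hap g ⟨hg0, hga, h0.symm.le⟩ (hgb g hga hgg)
  · have hag : h a g = 0 := by rw [hs g a, hga, map_zero]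
    obtain ⟨v, hv, hvg⟩ := exists_decomp_pair hs ha h0 hag hneg
    exact hap v hv (hgb v hv.2.1 hvg)

/-! ### From geodesics to vectors; transversality as non-tangency. -/

theorem mk_mem_points {C : ComplexGeodesic h} {v : V} (hv : IsSliceVec h C.vec v) :
    Projectivization.mk ℂ v hv.1 ∈ C.points := by
  obtain ⟨r, hr⟩ := Projectivization.exists_smul_eq_mk_rep ℂ v hv.1
  have h1 : IsSliceVec h C.vec ((r : ℂ) • v) := hv.smul r.ne_zero
  have h2 : (r : ℂ) • v = (Projectivization.mk ℂ v hv.1).rep := hr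
  rw [h2] at h1
  exact ⟨h1.2.2, h1.2.1⟩

theorem isSliceVec_rep {C : ComplexGeodesic h} {x : ℙ ℂ V} (hx : x ∈ C.points) :
    IsSliceVec h C.vec x.rep :=
  ⟨x.rep_nonzero, hx.2, hx.1⟩

theorem apart_of_ultraparallel {C C' : ComplexGeodesic h} (hu : C.Ultraparallel C') :
    Apart h C.vec C'.vec := fun _ hv hv' =>
  Set.disjoint_left.mp hu (mk_mem_points hv) (mk_mem_points ⟨hv.1, hv', hv.2.2⟩)

/-- The component of `v` along the spine vector `g` has coefficient `dirCoord / ⟨g, g⟩`, which is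
real, and the remainder is orthogonal to both polar vectors. -/
theorem mem_bisectorSpace (hs : ∀ x y : V, h y x = (starRingEnd ℂ) (h x y))
    (hneg : ∃ e, (h e e).re < 0) {C C' : ComplexGeodesic h} (hap : Apart h C.vec C'.vec) {v : V}
    (hv : h v C.vec = 0) (him : (dirCoord h C.vec C'.vec v).im = 0) :
    v ∈ bisectorSpace C C' := by
  have hC : 0 < (h C.vec C.vec).re := C.pos
  have hC' : 0 < (h C'.vec C'.vec).re := C'.pos
  have hgneg := hap.spineVec_neg hs hC hC' hneg
  have hgC := spineVec_orthogonal hC C'.vec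
  set g := spineVec h C.vec C'.vec with hg
  have hgmem : g ∈ realSpine C C' := by
    have e : h (h C.vec C'.vec • C'.vec) C.vec / h C.vec C.vec =
        ((Complex.normSq (h C.vec C'.vec) / (h C.vec C.vec).re : ℝ) : ℂ) := by
      rw [Complex.ofReal_div, ← self_eq_ofReal hs, ← Complex.mul_conj, ← hs]
      simp
    rw [hg, spineVec, e]
    refine Submodule.sub_mem _ (Submodule.subset_span (by simp [alignedVec])) ?_
    exact Submodule.smul_mem _ (_ : ℝ) (Submodule.subset_span (by simp))
  have hgg : h g g ≠ 0 := by
    intro h0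
    simp [h0] at hgneg
  have hba : h C'.vec C.vec ≠ 0 := hap.symm.apply_ne_zero hs hC' hC hneg
  set r : ℝ := (dirCoord h C.vec C'.vec v).re / (h g g).re with hr
  have hr' : (r : ℂ) * h g g = dirCoord h C.vec C'.vec v := by
    rw [self_eq_ofReal hs g, ← Complex.ofReal_mul, hr, div_mul_cancel₀ _ hgneg.ne]
    exact Complex.ext rfl (by simp [him])
  have hfoc : v - (r : ℂ) • g ∈ focusLine C C' := by
    have h1 : h (v - (r : ℂ) • g) C.vec = 0 := by simp [hv, hgC]
    have h2 : h (v - (r : ℂ) • g) g = 0 := by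
      simp only [map_sub, LinearMap.sub_apply, map_smul, LinearMap.smul_apply, smul_eq_mul, hr']
      rw [hg, apply_spineVec hs hv, sub_self]
    rw [hg, apply_spineVec hs h1] at h2
    exact ⟨h1, (mul_eq_zero.mp h2).resolve_right hba⟩
  have e : v = r • g + (v - (r : ℂ) • g) := by
    rw [Complex.coe_smul]
    abel
  rw [e]
  exact Submodule.add_mem_sup (Submodule.smul_mem _ _ hgmem) hfoc

theorem im_apply_eq_zero_of_mem_bisectorSpace (hs : ∀ x y : V, h y x = (starRingEnd ℂ) (h x y))
    {C C' : ComplexGeodesic h} {w : V} (hw : w ∈ bisectorSpace C C') : (h w C.vec).im = 0 := by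
  obtain ⟨y, hy, z, hz, rfl⟩ := Submodule.mem_sup.mp hw
  have hz' : h z C.vec = 0 := hz.1
  obtain ⟨s, t, rfl⟩ := Submodule.mem_span_pair.mp hy
  have e : h (alignedVec C C') C.vec = ((Complex.normSq (h C.vec C'.vec) : ℝ) : ℂ) := by
    rw [← Complex.mul_conj, ← hs]
    simp [alignedVec]
  rw [← Complex.coe_smul, ← Complex.coe_smul]
  simp only [map_add, LinearMap.add_apply, map_smul, LinearMap.smul_apply, e, hz', add_zero,
    smul_eq_mul]
  rw [self_eq_ofReal hs]
  simp

/-- The scalar turns `C.vec` into the aligned vector of the reversed bisector and the old aligned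
vector into a positive multiple of `C'.vec`. Reversal thus changes the real space only by a complex
factor, invisible to tangent spaces. -/
theorem smul_mem_bisectorSpace_swap (hs : ∀ x y : V, h y x = (starRingEnd ℂ) (h x y))
    {C C' : ComplexGeodesic h} {w : V} (hw : w ∈ bisectorSpace C C') :
    h C'.vec C.vec • w ∈ bisectorSpace C' C := by
  obtain ⟨y, hy, z, hz, rfl⟩ := Submodule.mem_sup.mp hw
  obtain ⟨s, t, rfl⟩ := Submodule.mem_span_pair.mp hy
  rw [smul_add]
  refine Submodule.add_mem_sup ?_ (Submodule.smul_mem (focusLine C' C) _ ⟨hz.2, hz.1⟩)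
  refine Submodule.mem_span_pair.mpr ⟨t * Complex.normSq (h C.vec C'.vec), s, ?_⟩
  have e : h C'.vec C.vec • alignedVec C C' = Complex.normSq (h C.vec C'.vec) • C'.vec := by
    rw [alignedVec, smul_smul, ← Complex.coe_smul, ← Complex.mul_conj, ← hs, mul_comm]
  rw [smul_add, smul_comm _ t, e, smul_comm _ s, smul_smul, alignedVec]
  abel

theorem tangentSpace_le_of_smul {W W' : Submodule ℝ V} {c : ℂ} (hc : c ≠ 0)
    (h₁ : ∀ w ∈ W, c • w ∈ W') (h₂ : ∀ w ∈ W', c⁻¹ • w ∈ W) (x : ℙ ℂ V) :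
    tangentSpace W x ≤ tangentSpace W' x := by
  intro φ hφ v hv
  obtain ⟨w, hw, e⟩ := hφ (c⁻¹ • v) (h₂ _ hv)
  refine ⟨c • w, h₁ w hw, ?_⟩
  rw [map_smul, ← e, map_smul, smul_smul, mul_inv_cancel₀ hc, one_smul]

theorem tangentSpace_bisectorSpace_swap (hs : ∀ x y : V, h y x = (starRingEnd ℂ) (h x y))
    (hneg : ∃ e, (h e e).re < 0) {C C' : ComplexGeodesic h} (hap : Apart h C.vec C'.vec)
    (x : ℙ ℂ V) : tangentSpace (bisectorSpace C' C) x ≤ tangentSpace (bisectorSpace C C') x := by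
  have hne := hap.apply_ne_zero hs C.pos C'.pos hneg
  refine tangentSpace_le_of_smul hne (fun w hw => smul_mem_bisectorSpace_swap hs hw)
    (fun w hw => ?_) x
  have h1 := Submodule.smul_mem _ (Complex.normSq (h C.vec C'.vec))⁻¹
    (smul_mem_bisectorSpace_swap hs hw)
  rw [← Complex.coe_smul, smul_smul, Complex.ofReal_inv, ← Complex.mul_conj, ← hs, mul_inv,
    inv_mul_cancel_right₀] at h1
  · exact h1
  · exact hap.symm.apply_ne_zero hs C'.pos C.pos hneg

/-- If the two coordinates at `v` are real multiples of each other, a complex factor makes both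
real, so one representative `v₀` lies in both bisector spaces. Both tangent spaces then satisfy the
same real equation, that the pairing with `A.vec` be real, and cannot span. -/
theorem nonTangent_of_transversalAlong (hs : ∀ x y : V, h y x = (starRingEnd ℂ) (h x y))
    (hneg : ∃ e, (h e e).re < 0) {A B C : ComplexGeodesic h} (hB : Apart h A.vec B.vec)
    (hC : Apart h A.vec C.vec) {W W' : Submodule ℝ V}
    (hW : W = bisectorSpace A B ∨ W = bisectorSpace B A)
    (hW' : W' = bisectorSpace A C ∨ W' = bisectorSpace C A)
    (ht : TransversalAlong W W' A.points) : NonTangent h A.vec B.vec C.vec := by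
  intro v hv him
  have hle : tangentSpace W (Projectivization.mk ℂ v hv.1) ≤
      tangentSpace (bisectorSpace A B) (Projectivization.mk ℂ v hv.1) := by
    rcases hW with rfl | rfl
    · exact le_rfl
    · exact tangentSpace_bisectorSpace_swap hs hneg hB _
  have hle' : tangentSpace W' (Projectivization.mk ℂ v hv.1) ≤
      tangentSpace (bisectorSpace A C) (Projectivization.mk ℂ v hv.1) := by
    rcases hW' with rfl | rfl
    · exact le_rfl
    · exact tangentSpace_bisectorSpace_swap hs hneg hC _
  have htop := ht _ (mk_mem_points hv)
  have htop' := eq_top_iff.mpr (htop ▸ sup_le_sup hle hle')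
  set x := Projectivization.mk ℂ v hv.1 with hx
  have hδ := hB.dirCoord_ne_zero hs A.pos B.pos hneg hv
  set c := (starRingEnd ℂ) (dirCoord h A.vec B.vec v) with hc
  have hc0 : c ≠ 0 := by simpa [hc] using hδ
  have hv₀ := hv.smul hc0
  set v₀ := c • v with hv₀e
  have hvx : ∀ w ∈ x.submodule, h w A.vec = 0 := by
    intro w hw
    rw [hx, Projectivization.submodule_mk] at hw
    obtain ⟨k, rfl⟩ := Submodule.mem_span_singleton.mp hw
    simp [hv.2.1]
  have hv₀x : v₀ ∈ x.submodule := by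
    rw [hx, Projectivization.submodule_mk]
    exact Submodule.smul_mem _ _ (Submodule.mem_span_singleton_self v)
  have hm₁ : v₀ ∈ bisectorSpace A B := by
    refine mem_bisectorSpace hs hneg hB hv₀.2.1 ?_
    rw [hv₀e, dirCoord_smul, hc, mul_comm, Complex.mul_conj, Complex.ofReal_im]
  have hm₂ : v₀ ∈ bisectorSpace A C := by
    refine mem_bisectorSpace hs hneg hC hv₀.2.1 ?_
    rw [hv₀e, dirCoord_smul, hc, mul_comm, im_mul_conj_swap, him, neg_zero]
  have hB₀ : h v₀ B.vec ≠ 0 := hB v₀ hv₀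
  -- A tangent vector with value `i A.vec` at `v₀` violates that equation; the pairing with `A.vec`
  -- is well defined modulo `x` because `x` is orthogonal to it.
  let φ : x.submodule →ₗ[ℂ] V ⧸ x.submodule :=
    ((h.flip B.vec).comp x.submodule.subtype).smulRight
      (x.submodule.mkQ (((h v₀ B.vec)⁻¹ * Complex.I) • A.vec))
  have hφ : φ ⟨v₀, hv₀x⟩ = x.submodule.mkQ (Complex.I • A.vec) := by
    change h v₀ B.vec • x.submodule.mkQ (((h v₀ B.vec)⁻¹ * Complex.I) • A.vec) = _
    rw [← map_smul, smul_smul, mul_inv_cancel_left₀ hB₀]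
  obtain ⟨φ₁, h₁, φ₂, h₂, hsum⟩ := Submodule.mem_sup.mp (htop' ▸ Submodule.mem_top : φ ∈ _)
  obtain ⟨w₁, hw₁, e₁⟩ := h₁ ⟨v₀, hv₀x⟩ hm₁
  obtain ⟨w₂, hw₂, e₂⟩ := h₂ ⟨v₀, hv₀x⟩ hm₂
  rw [← hsum, LinearMap.add_apply, e₁, e₂, ← map_add] at hφ
  have hdiff := hvx _ ((Submodule.Quotient.eq _).mp hφ)
  have him' := congrArg Complex.im hdiff
  simp only [map_sub, map_add, LinearMap.sub_apply, LinearMap.add_apply, Complex.sub_im,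
    Complex.add_im, im_apply_eq_zero_of_mem_bisectorSpace hs hw₁,
    im_apply_eq_zero_of_mem_bisectorSpace hs hw₂, map_smul, LinearMap.smul_apply, smul_eq_mul,
    Complex.I_mul_im, Complex.zero_im] at him'
  have : 0 < (h A.vec A.vec).re := A.pos
  linarith

/-! ### Rays turning once around the origin. -/

theorem toIcoMod_arg_of_im_nonneg {z : ℂ} (hz : 0 ≤ z.im) :
    toIcoMod Real.two_pi_pos 0 z.arg = z.arg := by
  rw [toIcoMod_eq_self]
  have h1 := Complex.arg_nonneg_iff.mpr hz
  have h2 := Complex.arg_le_pi z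
  have h3 := Real.pi_pos
  constructor <;> linarith

theorem toIcoMod_arg_of_im_neg {z : ℂ} (hz : z.im < 0) :
    toIcoMod Real.two_pi_pos 0 z.arg = z.arg + 2 * Real.pi := by
  have h1 := Complex.arg_neg_iff.mpr hz
  have h2 := Complex.neg_pi_lt_arg z
  have h3 := Real.pi_pos
  rw [← toIcoMod_add_right, toIcoMod_eq_self]
  constructor <;> linarith

theorem coe_arg_mul_conj {z w : ℂ} (hz : z ≠ 0) (hw : w ≠ 0) :
    ((z * (starRingEnd ℂ) w).arg : Real.Angle) = (z.arg : Real.Angle) - w.arg := by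
  rw [Complex.arg_mul_coe_angle hz (by simpa using hw), Complex.arg_conj_coe_angle, sub_eq_add_neg]

theorem sum_sub_one {n : ℕ} [NeZero n] {G : Type*} [AddCommMonoid G] (f : ZMod n → G) :
    ∑ i, f (i - 1) = ∑ i, f i :=
  (Equiv.subRight (1 : ZMod n)).sum_comp f

section Winding

variable {n : ℕ} [NeZero n] {d : ZMod n → ℂ}

theorem sum_arg_eq_two_pi_mul_int (hd : ∀ i, d i ≠ 0) :
    ∃ m : ℤ, ∑ i, (d i * (starRingEnd ℂ) (d (i - 1))).arg = 2 * Real.pi * m := by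
  have h0 : ((∑ i, (d i * (starRingEnd ℂ) (d (i - 1))).arg : ℝ) : Real.Angle) = (0 : ℝ) := by
    rw [← Real.Angle.coe_coeHom, map_sum]
    simp only [Real.Angle.coe_coeHom, coe_arg_mul_conj (hd _) (hd _), Finset.sum_sub_distrib]
    rw [sum_sub_one fun i => ((d i).arg : Real.Angle)]
    simp
  obtain ⟨m, hm⟩ := Real.Angle.angle_eq_iff_two_pi_dvd_sub.mp h0
  exact ⟨m, by simpa using hm⟩

/-- If the rays `d i` turn once around the origin, then each ray is in one of the half-open sectors
between consecutive rays only. -/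
theorem sector_unique (hd : ∀ i, 0 < (d i * (starRingEnd ℂ) (d (i - 1))).im)
    (hsum : ∑ i, (d i * (starRingEnd ℂ) (d (i - 1))).arg = 2 * Real.pi) {β : ℂ} {j k : ZMod n}
    (hj : ((starRingEnd ℂ) β * d (j - 1)).im < 0) (hj' : 0 ≤ ((starRingEnd ℂ) β * d j).im)
    (hk : ((starRingEnd ℂ) β * d (k - 1)).im < 0) (hk' : 0 ≤ ((starRingEnd ℂ) β * d k).im) :
    j = k := by
  have hπ := Real.pi_pos
  have hβ : β ≠ 0 := by
    rintro rfl
    simp at hj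
  have hd0 : ∀ i, d i ≠ 0 := by
    intro i h0
    have := hd i
    simp [h0] at this
  set θ : ZMod n → ℝ := fun i => (d i * (starRingEnd ℂ) (d (i - 1))).arg with hθ
  have hθpos : ∀ i, 0 < θ i := by
    intro i
    refine lt_of_le_of_ne (Complex.arg_nonneg_iff.mpr (hd i).le) fun h0 => ?_
    have := Complex.arg_eq_zero_iff.mp h0.symm
    exact (hd i).ne' this.2
  set ψ : ZMod n → ℝ := fun i => toIcoMod Real.two_pi_pos 0 (d i * (starRingEnd ℂ) β).arg with hψ
  have hψ0 : ∀ i, 0 ≤ ψ i := fun i => (toIcoMod_mem_Ico Real.two_pi_pos 0 _).1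
  have hψ1 : ∀ i, ψ i < 2 * Real.pi := fun i => by
    simpa using (toIcoMod_mem_Ico Real.two_pi_pos 0 (d i * (starRingEnd ℂ) β).arg).2
  -- `m i` counts the passages of the turn from `d (i - 1)` to `d i` through the ray of `β`. These
  -- numbers are nonnegative, their sum telescopes to `1`, and each sector containing `β`
  -- contributes at least `1`.
  have hm : ∀ i, ∃ m : ℤ, ψ (i - 1) + θ i - ψ i = 2 * Real.pi * m := by
    intro i
    apply Real.Angle.angle_eq_iff_two_pi_dvd_sub.mp
    rw [Real.Angle.coe_add]
    simp only [hψ, hθ, Real.Angle.coe_toIcoMod, coe_arg_mul_conj (hd0 _) hβ,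
      coe_arg_mul_conj (hd0 _) (hd0 _)]
    abel
  choose m hm using hm
  have hm0 : ∀ i, 0 ≤ m i := by
    intro i
    have h1 : 2 * Real.pi * (-1) < 2 * Real.pi * (m i : ℝ) := by
      rw [← hm i]
      have := hψ0 (i - 1)
      have := hψ1 i
      have := hθpos i
      linarith
    have h2 : (-1 : ℝ) < m i := lt_of_mul_lt_mul_left h1 (by linarith)
    have : (-1 : ℤ) < m i := by exact_mod_cast h2
    omega
  have hm1 : ∀ i, ((starRingEnd ℂ) β * d (i - 1)).im < 0 →
      0 ≤ ((starRingEnd ℂ) β * d i).im → 1 ≤ m i := by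
    intro i hi hi'
    rw [mul_comm] at hi hi'
    have h1 : ψ i ≤ Real.pi := by
      simp only [hψ, toIcoMod_arg_of_im_nonneg hi']
      exact Complex.arg_le_pi _
    have h2 : Real.pi < ψ (i - 1) := by
      simp only [hψ, toIcoMod_arg_of_im_neg hi]
      have := Complex.neg_pi_lt_arg (d (i - 1) * (starRingEnd ℂ) β)
      linarith
    have h3 : 2 * Real.pi * 0 < 2 * Real.pi * (m i : ℝ) := by
      rw [← hm i]
      have := hθpos i
      linarith
    have h4 : (0 : ℝ) < m i := lt_of_mul_lt_mul_left h3 (by linarith)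
    exact_mod_cast h4
  have hsum1 : ∑ i, m i = 1 := by
    have h1 : ∑ i, (ψ (i - 1) + θ i - ψ i) = 2 * Real.pi * ((∑ i, m i : ℤ) : ℝ) := by
      rw [Int.cast_sum, Finset.mul_sum]
      exact Finset.sum_congr rfl fun i _ => hm i
    rw [Finset.sum_sub_distrib, Finset.sum_add_distrib,
      sum_sub_one ψ, hsum] at h1
    have h2 : ((∑ i, m i : ℤ) : ℝ) = 1 := by
      have : 2 * Real.pi * (((∑ i, m i : ℤ) : ℝ) - 1) = 0 := by linarith
      rcases mul_eq_zero.mp this with h3 | h3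
      · linarith
      · linarith
    exact_mod_cast h2
  by_contra hne
  have h1 : ∑ i ∈ {j, k}, m i ≤ ∑ i, m i :=
    Finset.sum_le_sum_of_subset_of_nonneg (Finset.subset_univ _) fun i _ _ => hm0 i
  rw [Finset.sum_pair hne, hsum1] at h1
  have := hm1 j hj hj'
  have := hm1 k hk hk'
  omega

/-- If the rays `d i` turn once around the origin, then the open sectors from `d (i - 1)` to
`d (i + 1)` and from `d (j - 1)` to `d (j + 1)` intersect only if `i` and `j` are neighbours. -/
theorem double_sector_inter (hd : ∀ i, 0 < (d i * (starRingEnd ℂ) (d (i - 1))).im)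
    (hsum : ∑ i, (d i * (starRingEnd ℂ) (d (i - 1))).arg = 2 * Real.pi) {β : ℂ} {i j : ZMod n}
    (hi : (((starRingEnd ℂ) β * d (i - 1)).im < 0 ∧ 0 ≤ ((starRingEnd ℂ) β * d i).im) ∨
      (((starRingEnd ℂ) β * d i).im ≤ 0 ∧ 0 < ((starRingEnd ℂ) β * d (i + 1)).im))
    (hj : (((starRingEnd ℂ) β * d (j - 1)).im < 0 ∧ 0 ≤ ((starRingEnd ℂ) β * d j).im) ∨
      (((starRingEnd ℂ) β * d j).im ≤ 0 ∧ 0 < ((starRingEnd ℂ) β * d (j + 1)).im)) :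
    j = i - 1 ∨ j = i ∨ j = i + 1 := by
  have key : ∀ i : ZMod n,
      (((starRingEnd ℂ) β * d (i - 1)).im < 0 ∧ 0 ≤ ((starRingEnd ℂ) β * d i).im) ∨
      (((starRingEnd ℂ) β * d i).im ≤ 0 ∧ 0 < ((starRingEnd ℂ) β * d (i + 1)).im) →
      ∃ k, (k = i ∨ k = i + 1) ∧ ((starRingEnd ℂ) β * d (k - 1)).im < 0 ∧
        0 ≤ ((starRingEnd ℂ) β * d k).im := by
    rintro i (⟨h1, h2⟩ | ⟨h1, h2⟩)
    · exact ⟨i, Or.inl rfl, h1, h2⟩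
    · rcases h1.lt_or_eq with h1 | h1
      · exact ⟨i + 1, Or.inr rfl, by simpa using h1, h2.le⟩
      -- Here `β` is on the ray `d i`, the closed end of the sector that ends there.
      · refine ⟨i, Or.inl rfl, ?_, h1.ge⟩
        have a1 := hd i
        have a2 := hd (i + 1)
        rw [add_sub_cancel_right] at a2
        have b1 : ((starRingEnd ℂ) β * d (i + 1)).im * (d i * (starRingEnd ℂ) (d (i - 1))).im
            = -((starRingEnd ℂ) β * d (i - 1)).im * (d (i + 1) * (starRingEnd ℂ) (d i)).im
              + ((starRingEnd ℂ) β * d i).im * (d (i + 1) * (starRingEnd ℂ) (d (i - 1))).im := by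
          simp only [Complex.mul_im, Complex.conj_re, Complex.conj_im]
          ring
        rw [h1, zero_mul, add_zero] at b1
        have b2 := mul_pos h2 a1
        rw [b1] at b2
        linarith [pos_of_mul_pos_left b2 a2.le]
  obtain ⟨k, hk, h1, h2⟩ := key i hi
  obtain ⟨l, hl, h3, h4⟩ := key j hj
  obtain rfl := sector_unique hd hsum h1 h2 h3 h4
  rcases hk with rfl | rfl <;> rcases hl with h5 | h5
  · exact Or.inr (Or.inl h5.symm)
  · exact Or.inl (by rw [h5, add_sub_cancel_right])
  · exact Or.inr (Or.inr h5.symm)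
  · exact Or.inr (Or.inl (add_right_cancel h5).symm)

end Winding

/-- The sum of the angles of a cyclic family of bisectors with a common slice does not depend on the
point of this slice. -/
theorem sum_arg_eq (hs : ∀ x y : V, h y x = (starRingEnd ℂ) (h x y)) {n : ℕ} [NeZero n] {p : V}
    {q : ZMod n → V} (ht : ∀ i, Turns h 1 p (q i) (q (i - 1))) {v w : V}
    (hv : IsSliceVec h p v) (hw : IsSliceVec h p w) :
    ∑ i, (dirCoord h p (q i) v * (starRingEnd ℂ) (dirCoord h p (q (i - 1)) v)).arg =
      ∑ i, (dirCoord h p (q i) w * (starRingEnd ℂ) (dirCoord h p (q (i - 1)) w)).arg := by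
  obtain ⟨r, hr, hseg⟩ := hv.exists_segment hs hw
  set u : ℝ → V := fun t => ((1 - t : ℝ) : ℂ) • (r • v) + (t : ℂ) • w with hu
  set f : ℝ → ℝ := fun t =>
    ∑ i, (dirCoord h p (q i) (u t) * (starRingEnd ℂ) (dirCoord h p (q (i - 1)) (u t))).arg with hf
  have him : ∀ i, ∀ t ∈ Set.Icc (0 : ℝ) 1,
      0 < (dirCoord h p (q i) (u t) * (starRingEnd ℂ) (dirCoord h p (q (i - 1)) (u t))).im :=
    fun i t hT => by simpa only [one_mul] using ht i _ (hseg t hT)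
  -- Positive imaginary parts keep every term away from the branch cut of `arg`.
  have hcont : ContinuousOn f (Set.Icc 0 1) := by
    refine continuousOn_finsetSum _ fun i _ t hT => ContinuousAt.continuousWithinAt ?_
    refine ContinuousAt.comp (g := Complex.arg) (Complex.continuousAt_arg ?_) ?_
    · exact Or.inr (him i t hT).ne'
    · exact ((continuous_dirCoord_segment p (q i) _ _).mul
        (Complex.continuous_conj.comp
          (continuous_dirCoord_segment p (q (i - 1)) _ _))).continuousAt
  have hint : ∀ t ∈ Set.Icc (0 : ℝ) 1, ∃ m : ℤ, f t = 2 * Real.pi * m := by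
    intro t hT
    refine sum_arg_eq_two_pi_mul_int (d := fun i => dirCoord h p (q i) (u t)) fun i h0 => ?_
    have := him i t hT
    simp [h0] at this
  have h0 : f 0 = ∑ i,
      (dirCoord h p (q i) v * (starRingEnd ℂ) (dirCoord h p (q (i - 1)) v)).arg := by
    refine Finset.sum_congr rfl fun i _ => ?_
    have e : u 0 = r • v := by simp [hu]
    have e2 : dirCoord h p (q i) (u 0) * (starRingEnd ℂ) (dirCoord h p (q (i - 1)) (u 0)) =
        (Complex.normSq r : ℂ) *
          (dirCoord h p (q i) v * (starRingEnd ℂ) (dirCoord h p (q (i - 1)) v)) := by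
      rw [e, dirCoord_smul, dirCoord_smul, map_mul, ← Complex.mul_conj]
      ring
    rw [e2, Complex.arg_real_mul _ (Complex.normSq_pos.mpr hr)]
  have h1 : f 1 = ∑ i,
      (dirCoord h p (q i) w * (starRingEnd ℂ) (dirCoord h p (q (i - 1)) w)).arg := by
    have e : u 1 = w := by simp [hu]
    simp only [hf, e]
  rw [← h0, ← h1]
  obtain ⟨a, ha⟩ := hint 0 (by simp)
  obtain ⟨b, hb⟩ := hint 1 (by simp)
  have hπ := Real.pi_pos
  -- With values in `2πℤ`, `f` omits the odd multiples of `π` and cannot move between different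
  -- values.
  have hno : ∀ c : ℤ, 2 * Real.pi * c + Real.pi ∉ Set.uIcc (f 0) (f 1) := by
    intro c hc
    have hcont' : ContinuousOn f (Set.uIcc 0 1) := by rwa [Set.uIcc_of_le zero_le_one]
    obtain ⟨t, hT, hft⟩ := intermediate_value_uIcc hcont' hc
    rw [Set.uIcc_of_le zero_le_one] at hT
    obtain ⟨m, hm⟩ := hint t hT
    rw [hm] at hft
    have h3 : Real.pi * (2 * (m : ℝ) - 2 * c - 1) = 0 := by linarith
    have h4 := (mul_eq_zero.mp h3).resolve_left hπ.ne'
    have h5 : 2 * m - 2 * c - 1 = 0 := by exact_mod_cast h4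
    omega
  have hstep : ∀ a b : ℤ, a < b → 2 * Real.pi * a + Real.pi ≤ 2 * Real.pi * b := by
    intro a b hab
    have h2 : (a : ℝ) + 1 ≤ b := by exact_mod_cast hab
    have := mul_le_mul_of_nonneg_left h2 (by linarith : 0 ≤ 2 * Real.pi)
    linarith
  rcases lt_trichotomy a b with hab | hab | hab
  · exact absurd (Set.mem_uIcc.mpr (Or.inl ⟨by linarith, by rw [hb]; exact hstep a b hab⟩)) (hno a)
  · rw [ha, hb, hab]
  · exact absurd (Set.mem_uIcc.mpr (Or.inr ⟨by linarith, by rw [ha]; exact hstep b a hab⟩)) (hno b)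

/-! ### Oriented angles and sectors in terms of coordinates. -/

theorem orientedAngle_eq (hs : ∀ x y : V, h y x = (starRingEnd ℂ) (h x y))
    (hneg : ∃ e, (h e e).re < 0) {C M M' : ComplexGeodesic h} (hM : Apart h C.vec M.vec)
    (hM' : Apart h C.vec M'.vec) {s : ℙ ℂ V} (hsC : s ∈ C.points) :
    C.orientedAngle M M' s = toIcoMod Real.two_pi_pos 0
      (dirCoord h C.vec M'.vec s.rep * (starRingEnd ℂ) (dirCoord h C.vec M.vec s.rep)).arg := by
  have hg := hM.spineVec_neg hs C.pos M.pos hneg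
  have hg' := hM'.spineVec_neg hs C.pos M'.pos hneg
  have hC : 0 < (h C.vec C.vec).re := C.pos
  have e : ∀ N : ComplexGeodesic h, normalVec C N s.rep = (Complex.I *
      (dirCoord h C.vec N.vec s.rep /
        ((h (spineVec h C.vec N.vec) (spineVec h C.vec N.vec)).re : ℂ))) • C.vec := by
    intro N
    rw [← self_eq_ofReal hs, ← apply_spineVec hs (isSliceVec_rep hsC).2.1]
    rfl
  have eM := e M
  have eM' := e M'
  generalize (h (spineVec h C.vec M.vec) (spineVec h C.vec M.vec)).re = g at eM hg
  generalize (h (spineVec h C.vec M'.vec) (spineVec h C.vec M'.vec)).re = g' at eM' hg'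
  have e2 : h (normalVec C M' s.rep) (normalVec C M s.rep) =
      (((h C.vec C.vec).re / (g' * g) : ℝ) : ℂ) *
      (dirCoord h C.vec M'.vec s.rep * (starRingEnd ℂ) (dirCoord h C.vec M.vec s.rep)) := by
    rw [eM, eM']
    simp only [map_smul, LinearMap.smul_apply, map_smulₛₗ, smul_eq_mul, map_mul, map_div₀,
      Complex.conj_I, Complex.conj_ofReal, Complex.ofReal_div, Complex.ofReal_mul]
    rw [self_eq_ofReal hs C.vec]
    ring_nf
    simp only [Complex.I_sq]
    simp
  -- The factors `i` cancel, and both spine vectors are negative, so the remaining real factor is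
  -- positive.
  rw [orientedAngle, e2, Complex.arg_real_mul _ (div_pos hC (mul_pos_of_neg_of_neg hg' hg))]

theorem im_div_mul_normSq (z : ℂ) {w : ℂ} (hw : w ≠ 0) :
    (z / w).im * Complex.normSq w = (z * (starRingEnd ℂ) w).im := by
  have h1 : z * (starRingEnd ℂ) w = (Complex.normSq w : ℂ) * (z / w) := by
    rw [← Complex.mul_conj]
    field_simp
  rw [h1, Complex.im_ofReal_mul, mul_comm]

theorem side_nonneg_of_mem_posHalfSpace (hs : ∀ x y : V, h y x = (starRingEnd ℂ) (h x y))
    {C M : ComplexGeodesic h} (hne : h C.vec M.vec ≠ 0) {x : ℙ ℂ V}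
    (hx : x ∈ posHalfSpace C M) : 0 ≤ side h C.vec M.vec x.rep := by
  rw [side, hs C.vec M.vec, ← im_div_mul_normSq _ hne]
  exact mul_nonneg hx.2 (Complex.normSq_nonneg _)

theorem side_nonpos_of_mem_negHalfSpace (hs : ∀ x y : V, h y x = (starRingEnd ℂ) (h x y))
    {C M : ComplexGeodesic h} (hne : h C.vec M.vec ≠ 0) {x : ℙ ℂ V}
    (hx : x ∈ negHalfSpace C M) : side h C.vec M.vec x.rep ≤ 0 := by
  rw [side, hs C.vec M.vec, ← im_div_mul_normSq _ hne]
  exact mul_nonpos_of_nonpos_of_nonneg hx.2 (Complex.normSq_nonneg _)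

/-- An angle at most `π` at one point makes the imaginary part nonnegative there; non-tangency makes
it positive and propagates its sign along `C`. -/
theorem turns_of_orientedAngle_le (hs : ∀ x y : V, h y x = (starRingEnd ℂ) (h x y))
    (hneg : ∃ e, (h e e).re < 0) {C M M' : ComplexGeodesic h} (hM : Apart h C.vec M.vec)
    (hM' : Apart h C.vec M'.vec) (ht : NonTangent h C.vec M'.vec M.vec)
    (hangle : ∃ c ∈ C.points ∩ openBall h, C.orientedAngle M M' c ≤ Real.pi) :
    Turns h 1 C.vec M'.vec M.vec := by
  obtain ⟨c, hc, hle⟩ := hangle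
  rw [orientedAngle_eq hs hneg hM hM' hc.1] at hle
  refine Turns.eq_sign hs ht (isSliceVec_rep hc.1) ?_ (Or.inl rfl)
  rw [one_mul]
  by_contra hcon
  rw [toIcoMod_arg_of_im_neg (not_le.mp hcon)] at hle
  linarith [Complex.neg_pi_lt_arg (dirCoord h C.vec M'.vec c.rep *
    (starRingEnd ℂ) (dirCoord h C.vec M.vec c.rep))]

theorem orientedAngle_eq_arg (hs : ∀ x y : V, h y x = (starRingEnd ℂ) (h x y))
    (hneg : ∃ e, (h e e).re < 0) {C M M' : ComplexGeodesic h} (hM : Apart h C.vec M.vec)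
    (hM' : Apart h C.vec M'.vec) (ht : Turns h 1 C.vec M'.vec M.vec) {c : ℙ ℂ V}
    (hc : c ∈ C.points) : C.orientedAngle M M' c =
      (dirCoord h C.vec M'.vec c.rep * (starRingEnd ℂ) (dirCoord h C.vec M.vec c.rep)).arg := by
  rw [orientedAngle_eq hs hneg hM hM' hc, toIcoMod_arg_of_im_nonneg]
  simpa only [one_mul] using (ht _ (isSliceVec_rep hc)).le

theorem orientedAngle_lt_pi (hs : ∀ x y : V, h y x = (starRingEnd ℂ) (h x y))
    (hneg : ∃ e, (h e e).re < 0) {C M M' : ComplexGeodesic h} (hM : Apart h C.vec M.vec)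
    (hM' : Apart h C.vec M'.vec) (ht : Turns h 1 C.vec M'.vec M.vec) {c : ℙ ℂ V}
    (hc : c ∈ C.points) : C.orientedAngle M M' c < Real.pi := by
  rw [orientedAngle_eq_arg hs hneg hM hM' ht hc]
  refine lt_of_le_of_ne (Complex.arg_le_pi _) fun h0 => ?_
  have h1 := ht _ (isSliceVec_rep hc)
  rw [one_mul, (Complex.arg_eq_pi_iff.mp h0).2] at h1
  exact lt_irrefl _ h1

theorem sides_of_mem_interiorSector (hs : ∀ x y : V, h y x = (starRingEnd ℂ) (h x y))
    (hneg : ∃ e, (h e e).re < 0) {C M M' : ComplexGeodesic h} (hM : Apart h C.vec M.vec)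
    (hM' : Apart h C.vec M'.vec) (ht : Turns h 1 C.vec M'.vec M.vec)
    (hc : (C.points ∩ openBall h).Nonempty) {x : ℙ ℂ V} (hx : x ∈ interiorSector C M M') :
    0 ≤ side h C.vec M.vec x.rep ∧ side h C.vec M'.vec x.rep ≤ 0 := by
  obtain ⟨c, hc⟩ := hc
  have hlt := orientedAngle_lt_pi hs hneg hM hM' ht hc.1
  -- As the angle is less than `π`, the interior sector is the intersection of half-spaces.
  rw [interiorSector, if_pos ⟨c, hc, hlt⟩, sector, if_pos ⟨c, hc, hlt.le⟩] at hx
  exact ⟨side_nonneg_of_mem_posHalfSpace hs (hM.apply_ne_zero hs C.pos M.pos hneg) hx.1,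
    side_nonpos_of_mem_negHalfSpace hs (hM'.apply_ne_zero hs C.pos M'.pos hneg) hx.2⟩

/-! ### The two halves of a bisector segment. -/

/-- The point represented by `x` is on one of the slices from the one polar to `q` to the one polar
to `s`. -/
def OnSegment (h : V →ₗ[ℂ] V →ₗ⋆[ℂ] ℂ) (q s x : V) : Prop :=
  ∃ ρ σ : ℝ, 0 ≤ ρ ∧ 0 ≤ σ ∧ (ρ ≠ 0 ∨ σ ≠ 0) ∧ (ρ : ℂ) * h x q + σ * dirCoord h q s x = 0

theorem exists_smul_vec_eq {M : ComplexGeodesic h} {v : V} (hv : v ∈ M.polar.submodule) :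
    ∃ c : ℂ, c • M.vec = v := by
  rw [Projectivization.submodule_eq] at hv
  exact Submodule.mem_span_singleton.mp hv

theorem apply_eq_zero_of_mem_points {M : ComplexGeodesic h} {v : V}
    (hv : v ∈ M.polar.submodule) {x : ℙ ℂ V} (hx : x ∈ M.points) : h x.rep v = 0 := by
  obtain ⟨c, rfl⟩ := exists_smul_vec_eq hv
  simp [hx.2]

/-- A slice of a bisector segment divides the segment in two. -/
theorem onSegment_of_mem_bisectorSegment (hs : ∀ x y : V, h y x = (starRingEnd ℂ) (h x y))
    {S S' M : ComplexGeodesic h} (hSS' : h S.vec S'.vec ≠ 0) (hM : IsSliceBetween S S' M)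
    {x : ℙ ℂ V} (hx : x ∈ bisectorSegment S S') :
    OnSegment h M.vec S.vec x.rep ∨ OnSegment h M.vec S'.vec x.rep := by
  obtain ⟨N, ⟨w, ⟨r₀, r₁, hr₀, hr₁, -, rfl⟩, hw0, hwN⟩, hxN⟩ := hx
  obtain ⟨v, ⟨m₀, m₁, hm₀, hm₁, -, rfl⟩, hv0, hvM⟩ := hM
  have hxw := apply_eq_zero_of_mem_points hwN hxN
  obtain ⟨c, hc⟩ := exists_smul_vec_eq hvM
  have hc0 : c ≠ 0 := by
    rintro rfl
    exact hv0 (by rw [← hc, zero_smul])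
  have hc0' : (starRingEnd ℂ) c ≠ 0 := by simpa using hc0
  have hcM : ∀ y, (starRingEnd ℂ) c * h y M.vec =
      m₀ * h y S.vec + m₁ * (h S'.vec S.vec * h y S'.vec) := by
    intro y
    have := congrArg (h y) hc
    simpa [alignedVec, ← Complex.coe_smul, ← hs S.vec S'.vec] using this
  have hxw' : (r₀ : ℂ) * h x.rep S.vec + r₁ * (h S'.vec S.vec * h x.rep S'.vec) = 0 := by
    simpa [alignedVec, ← Complex.coe_smul, ← hs S.vec S'.vec] using hxw
  have hS : 0 < (h S.vec S.vec).re := S.pos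
  have hS' : 0 < (h S'.vec S'.vec).re := S'.pos
  have hn : 0 < Complex.normSq (h S.vec S'.vec) := Complex.normSq_pos.mpr hSS'
  have hm : m₀ ≠ 0 ∨ m₁ ≠ 0 := by
    by_contra hcon
    push Not at hcon
    simp [hcon.1, hcon.2] at hv0
  have hr : r₀ ≠ 0 ∨ r₁ ≠ 0 := by
    by_contra hcon
    push Not at hcon
    simp [hcon.1, hcon.2] at hw0
  rcases le_or_gt (r₁ * m₀) (r₀ * m₁) with hcmp | hcmp
  · left
    -- For `m₁ = 0` the slice `M` is `S` itself and the general coefficients could both vanish; then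
    -- `x` is on `S`.
    rcases hm₁.eq_or_lt with h0 | h0
    · subst h0
      have hm₀' : 0 < m₀ := lt_of_le_of_ne hm₀ (by simpa [eq_comm] using hm)
      have hr₁' : r₁ = 0 := by
        rw [mul_zero] at hcmp
        exact le_antisymm (nonpos_of_mul_nonpos_left hcmp hm₀') hr₁
      subst hr₁'
      have hxS : h x.rep S.vec = 0 := by simpa [by simpa using hr] using hxw'
      exact ⟨0, 1, le_rfl, zero_le_one, by simp, by simp [dirCoord, hxS]⟩
    -- For the spine vectors `v` of `M` and `w` of the slice through `x`, `m₁ w = r₁ v + (r₀ m₁ - r₁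
    -- m₀) S.vec`. The factor `η = ⟨S.vec, v⟩` accounts for the alignment built into `dirCoord`.
    · set η : ℝ := m₀ * (h S.vec S.vec).re + m₁ * Complex.normSq (h S.vec S'.vec) with hη
      have hηpos : 0 < η := add_pos_of_nonneg_of_pos (mul_nonneg hm₀ hS.le) (mul_pos h0 hn)
      have hcη : (starRingEnd ℂ) c * h S.vec M.vec = η := by
        rw [hcM, hη, Complex.ofReal_add, Complex.ofReal_mul, Complex.ofReal_mul,
          ← Complex.mul_conj, ← hs S.vec S'.vec, ← self_eq_ofReal hs]
        ring
      refine ⟨r₁ * η, r₀ * m₁ - r₁ * m₀, mul_nonneg hr₁ hηpos.le, sub_nonneg.mpr hcmp, ?_, ?_⟩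
      · by_contra hcon
        push Not at hcon
        have h1 : r₁ = 0 := (mul_eq_zero.mp hcon.1).resolve_right hηpos.ne'
        have h2 := hcon.2
        rw [h1, zero_mul, sub_zero] at h2
        exact (hr.resolve_right (not_not.mpr h1)) ((mul_eq_zero.mp h2).resolve_right h0.ne')
      · refine (mul_eq_zero.mp ?_).resolve_left hc0'
        simp only [dirCoord]
        push_cast
        linear_combination (r₁ * η : ℂ) * hcM x.rep +
          ((r₀ : ℂ) * m₁ - r₁ * m₀) * h x.rep S.vec * hcη + (m₁ * η : ℂ) * hxw'
  · right
    have hm₀' : 0 < m₀ := by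
      refine lt_of_le_of_ne hm₀ fun h0 => ?_
      rw [← h0, mul_zero] at hcmp
      exact absurd hcmp (not_lt.mpr (mul_nonneg hr₀ hm₁))
    set η : ℝ := m₀ + m₁ * (h S'.vec S'.vec).re with hη
    have hηpos : 0 < η := add_pos_of_pos_of_nonneg hm₀' (mul_nonneg hm₁ hS'.le)
    have hcη : (starRingEnd ℂ) c * h S'.vec M.vec = h S'.vec S.vec * η := by
      rw [hcM, hη, Complex.ofReal_add, Complex.ofReal_mul, ← self_eq_ofReal hs]
      ring
    refine ⟨r₀ * η, r₁ * m₀ - r₀ * m₁, mul_nonneg hr₀ hηpos.le, (sub_pos.mpr hcmp).le,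
      Or.inr (sub_pos.mpr hcmp).ne', ?_⟩
    refine (mul_eq_zero.mp ?_).resolve_left hc0'
    simp only [dirCoord]
    push_cast
    linear_combination (r₀ * η : ℂ) * hcM x.rep +
      ((r₁ : ℂ) * m₀ - r₀ * m₁) * h x.rep S'.vec * hcη + (m₀ * η : ℂ) * hxw'

theorem reflect_eq_self {M : ComplexGeodesic h} {x : ℙ ℂ V} (hx : x ∈ M.points) :
    M.reflect x = x := by
  have e : reflection h M.vec x.rep = -x.rep := by
    simp [reflection, hx.2]
  conv_lhs => rw [← x.mk_rep]
  conv_rhs => rw [← x.mk_rep]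
  rw [reflect, Projectivization.map_mk, Projectivization.mk_eq_mk_iff']
  exact ⟨-1, by rw [e, neg_one_smul]⟩

/-- The reflection in `M` fixes the points of `M`, so a point common to `M` and one end would lie on
both ends. -/
theorem apart_of_isMiddleSlice {S S' M : ComplexGeodesic h} (hM : IsMiddleSlice S S' M)
    (hu : S.Ultraparallel S') : Apart h S.vec M.vec ∧ Apart h S'.vec M.vec := by
  constructor <;> refine apart_of_ultraparallel (Set.disjoint_left.mpr fun x hx hxM => ?_)
  · refine Set.disjoint_left.mp hu hx ?_
    rw [← hM.2.1]
    exact ⟨x, hx, reflect_eq_self hxM⟩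
  · refine Set.disjoint_left.mp hu ?_ hx
    rw [← hM.2.2]
    exact ⟨x, hx, reflect_eq_self hxM⟩

/-- The slice of `b` is strictly on one side of the bisector from `a` to `c`, which contains the
slice of `c`. This yields the disjointness of consecutive middle slices. -/
theorem Turns.apart (hs : ∀ x y : V, h y x = (starRingEnd ℂ) (h x y)) {a b c : V} {ε : ℝ}
    (ht : Turns h ε a b c) (ha : 0 < (h a a).re) (hab : h a b ≠ 0) : Apart h b c := by
  intro v hv hvc
  have := ht.side_pos_of_isSliceVec hs ha hab hv
  simp [side, hvc] at this

theorem IsHermitianPPM.exists_neg (hh : IsHermitianPPM h) : ∃ e, (h e e).re < 0 := by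
  obtain ⟨e, he⟩ := hh.signature
  exact ⟨e 2, by simp [he]⟩

/-- The two sides of the triangle at `S` that are adjacent to `S` lie in the interior sector at `C`
of the triangle `Δ(C, M₁, M₂)`. -/
theorem onSegment_sides (hs : ∀ x y : V, h y x = (starRingEnd ℂ) (h x y))
    (hneg : ∃ e, (h e e).re < 0) {C M₁ M₂ S : ComplexGeodesic h} (a₁ : Apart h C.vec M₁.vec)
    (a₂ : Apart h C.vec M₂.vec) (s₁ : Apart h S.vec M₁.vec) (s₂ : Apart h S.vec M₂.vec)
    (ht : Turns h 1 C.vec M₂.vec M₁.vec) (hΔ : C.IsTransversalTriangle M₁ M₂)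
    (hΔ' : S.IsTransversalTriangle M₂ M₁) (hadj : S.IsTransversallyAdjacent M₂ M₁ C)
    (hc : (C.points ∩ openBall h).Nonempty) {x : V} (hx0 : x ≠ 0) (hx : (h x x).re ≤ 0) :
    (OnSegment h M₁.vec S.vec x → side h C.vec M₂.vec x < 0 ∧ 0 ≤ side h C.vec M₁.vec x) ∧
    (OnSegment h M₂.vec S.vec x → 0 < side h C.vec M₁.vec x ∧ side h C.vec M₂.vec x ≤ 0) := by
  obtain ⟨⟨x₀, hx₀S, hx₀⟩, j₁, j₂⟩ := hadj
  obtain ⟨-, d₁, d₂⟩ := hΔ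
  obtain ⟨e₀, e₂, e₁⟩ := hΔ'
  obtain ⟨b₁, b₂⟩ := sides_of_mem_interiorSector hs hneg a₁ a₂ ht hc hx₀
  have m₂₁ : Apart h M₂.vec M₁.vec := ht.apart hs C.pos (a₂.apply_ne_zero hs C.pos M₂.pos hneg)
  have n₁ : NonTangent h M₁.vec S.vec C.vec := (nonTangent_of_transversalAlong hs hneg a₁.symm
    s₁.symm (Or.inr rfl) (Or.inl rfl) j₁).swap
  have n₂ : NonTangent h M₂.vec S.vec C.vec := (nonTangent_of_transversalAlong hs hneg a₂.symm
    s₂.symm (Or.inl rfl) (Or.inr rfl) j₂).swap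
  have n₃ : NonTangent h M₁.vec M₂.vec C.vec := (nonTangent_of_transversalAlong hs hneg a₁.symm
    m₂₁.symm (Or.inr rfl) (Or.inl rfl) d₁).swap
  have n₄ : NonTangent h M₂.vec M₁.vec C.vec := nonTangent_of_transversalAlong hs hneg m₂₁
    a₂.symm (Or.inr rfl) (Or.inl rfl) d₂
  have n₅ : NonTangent h S.vec M₂.vec M₁.vec := nonTangent_of_transversalAlong hs hneg s₂ s₁
    (Or.inl rfl) (Or.inr rfl) e₀
  have n₆ : NonTangent h M₂.vec S.vec M₁.vec := nonTangent_of_transversalAlong hs hneg s₂.symm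
    m₂₁ (Or.inr rfl) (Or.inl rfl) e₂
  have n₇ : NonTangent h M₁.vec M₂.vec S.vec := nonTangent_of_transversalAlong hs hneg m₂₁.symm
    s₁.symm (Or.inr rfl) (Or.inl rfl) e₁
  have hC : 0 < (h C.vec C.vec).re := C.pos
  have h₁ : 0 < (h M₁.vec M₁.vec).re := M₁.pos
  have h₂ : 0 < (h M₂.vec M₂.vec).re := M₂.pos
  have hS : 0 < (h S.vec S.vec).re := S.pos
  constructor
  · rintro ⟨ρ, σ, hρ, hσ, hρσ, hslice⟩
    have := segment_subset_sector hs hneg (Or.inr rfl) hC h₁ h₂ hS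
      (a₁.apply_ne_zero hs hC h₁ hneg) (m₂₁.apply_ne_zero hs h₂ h₁ hneg)
      (s₁.symm.apply_ne_zero hs h₁ hS hneg) (s₂.symm.apply_ne_zero hs h₂ hS hneg) ht.swap
      n₄ n₂ n₁ n₆.swap n₅.swap n₇.swap (isSliceVec_rep hx₀S) (by linarith) (by linarith) hx0 hx hρ
      hσ hρσ hslice
    constructor <;> linarith
  · rintro ⟨ρ, σ, hρ, hσ, hρσ, hslice⟩
    have := segment_subset_sector hs hneg (Or.inl rfl) hC h₂ h₁ hS
      (a₂.apply_ne_zero hs hC h₂ hneg) (m₂₁.symm.apply_ne_zero hs h₁ h₂ hneg)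
      (s₂.symm.apply_ne_zero hs h₂ hS hneg) (s₁.symm.apply_ne_zero hs h₁ hS hneg) ht
      n₃ n₁ n₂ n₇ n₅ n₆ (isSliceVec_rep hx₀S) (by linarith) (by linarith) hx0 hx hρ
      hσ hρσ hslice
    constructor <;> linarith

end Vectors

end ComplexHyperbolic

/-! ### The main theorem. -/

theorem mainTheorem8 {V : Type*} [AddCommGroup V] [Module ℂ V]
    (h : V →ₗ[ℂ] V →ₗ⋆[ℂ] ℂ) (hh : ComplexHyperbolic.IsHermitianPPM h)
    (n : ℕ) [NeZero n] (K : ComplexHyperbolic.Configuration h n) (hK : K.IsTransversal)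
    (M : ZMod n → ComplexHyperbolic.ComplexGeodesic h) (hM : K.AreMiddleSlices M)
    (C : ComplexHyperbolic.ComplexGeodesic h) (hC : ComplexHyperbolic.IsCentre M C)
    (hΔ : ∀ i, C.IsTransversalTriangle (M (i - 1)) (M i))
    (hΔ' : ∀ i, (K.S i).IsTransversalTriangle (M i) (M (i - 1)))
    (hadj : ∀ i, (K.S i).IsTransversallyAdjacent (M i) (M (i - 1)) C)
    (hcentral : ∃ c ∈ C.points ∩ ComplexHyperbolic.openBall h,
      ComplexHyperbolic.centralAngle M C c = 2 * Real.pi)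
    (hangle : ∀ i, ∃ c ∈ C.points ∩ ComplexHyperbolic.openBall h,
      C.orientedAngle (M (i - 1)) (M i) c ≤ Real.pi) :
    K.IsSimple := by
  have hs := hh.hermitian
  have hneg := hh.exists_neg
  have hCpos : 0 < (h C.vec C.vec).re := C.pos
  have aC : ∀ i, ComplexHyperbolic.Apart h C.vec (M i).vec := fun i =>
    ComplexHyperbolic.apart_of_ultraparallel (hC.1 i)
  have aS : ∀ i, ComplexHyperbolic.Apart h (K.S i).vec (M i).vec := fun i =>
    (ComplexHyperbolic.apart_of_isMiddleSlice (hM i) (K.ultraparallel i)).1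
  have aS' : ∀ i, ComplexHyperbolic.Apart h (K.S i).vec (M (i - 1)).vec := fun i => by
    have := (ComplexHyperbolic.apart_of_isMiddleSlice (hM (i - 1)) (K.ultraparallel (i - 1))).2
    rwa [sub_add_cancel] at this
  have ht : ∀ i, ComplexHyperbolic.Turns h 1 C.vec (M i).vec (M (i - 1)).vec := fun i =>
    ComplexHyperbolic.turns_of_orientedAngle_le hs hneg (aC _) (aC _)
      (ComplexHyperbolic.nonTangent_of_transversalAlong hs hneg (aC _) (aC _) (Or.inl rfl)
        (Or.inl rfl) (hC.2 i)).swap (hangle i)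
  obtain ⟨c, hc, hcsum⟩ := hcentral
  have hcv := ComplexHyperbolic.isSliceVec_rep hc.1
  have hsum : ∀ v, ComplexHyperbolic.IsSliceVec h C.vec v →
      ∑ i, (ComplexHyperbolic.dirCoord h C.vec (M i).vec v *
        (starRingEnd ℂ) (ComplexHyperbolic.dirCoord h C.vec (M (i - 1)).vec v)).arg =
        2 * Real.pi := by
    intro v hv
    rw [ComplexHyperbolic.sum_arg_eq hs (q := fun i => (M i).vec) ht hv hcv, ← hcsum]
    exact Finset.sum_congr rfl fun i _ =>
      (ComplexHyperbolic.orientedAngle_eq_arg hs hneg (aC _) (aC _) (ht i) hc.1).symm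
  refine ⟨?_, fun i => (hK i).1⟩
  rintro i j ⟨x, hxi, hxj⟩
  have hx : (h x.rep x.rep).re ≤ 0 := by
    obtain ⟨N, -, hN⟩ := hxi
    exact hN.1
  obtain ⟨α, v, hxv, hv⟩ := ComplexHyperbolic.exists_decomp hs hCpos x.rep_nonzero hx
  -- On a segment leaving `C`, `α` is a negative multiple of the coordinate of its end, so it is
  -- `-α` that is compared with the rays.
  have hside : ∀ k, ComplexHyperbolic.side h C.vec (M k).vec x.rep =
      -((h C.vec C.vec).re * ((starRingEnd ℂ) (-α) *
        ComplexHyperbolic.dirCoord h C.vec (M k).vec v).im) := by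
    intro k
    rw [hxv, ComplexHyperbolic.side_decomp hs hv.2.1, map_neg, neg_mul, Complex.neg_im]
    ring
  have key : ∀ k, x ∈ K.B k →
      (((starRingEnd ℂ) (-α) * ComplexHyperbolic.dirCoord h C.vec (M (k - 1)).vec v).im < 0 ∧
        0 ≤ ((starRingEnd ℂ) (-α) * ComplexHyperbolic.dirCoord h C.vec (M k).vec v).im) ∨
      (((starRingEnd ℂ) (-α) * ComplexHyperbolic.dirCoord h C.vec (M k).vec v).im ≤ 0 ∧
        0 < ((starRingEnd ℂ) (-α) *
          ComplexHyperbolic.dirCoord h C.vec (M (k + 1)).vec v).im) := by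
    intro k hk
    -- The half of `B k` towards `S k` is a side of the triangle at `S k`; the other half belongs to
    -- the triangle at `S (k + 1)`.
    rcases ComplexHyperbolic.onSegment_of_mem_bisectorSegment hs
      ((ComplexHyperbolic.apart_of_ultraparallel (K.ultraparallel k)).apply_ne_zero hs
        (K.S k).pos (K.S (k + 1)).pos hneg) (hM k).1 hk with h1 | h1
    · left
      have h2 := (ComplexHyperbolic.onSegment_sides hs hneg (aC _) (aC _) (aS' k) (aS k) (ht k)
        (hΔ k) (hΔ' k) (hadj k) ⟨c, hc⟩ x.rep_nonzero hx).2 h1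
      rw [hside, hside, neg_pos, neg_nonpos] at h2
      exact ⟨neg_of_mul_neg_right h2.1 hCpos.le, nonneg_of_mul_nonneg_right h2.2 hCpos⟩
    · right
      have e : k + 1 - 1 = k := add_sub_cancel_right k 1
      have h2 := (ComplexHyperbolic.onSegment_sides hs hneg (aC _) (aC _) (aS' (k + 1))
        (aS (k + 1)) (ht (k + 1)) (hΔ (k + 1)) (hΔ' (k + 1)) (hadj (k + 1)) ⟨c, hc⟩
        x.rep_nonzero hx).1 (by rw [e]; exact h1)
      rw [e, hside, hside, neg_lt_zero, neg_nonneg] at h2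
      exact ⟨nonpos_of_mul_nonpos_right h2.2 hCpos, pos_of_mul_pos_right h2.1 hCpos.le⟩
  exact ComplexHyperbolic.double_sector_inter
    (d := fun k => ComplexHyperbolic.dirCoord h C.vec (M k).vec v)
    (fun k => by simpa only [one_mul] using ht k v hv) (hsum v hv) (key i hxi) (key j hxj)
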